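/- There is an absolute constant $C>0$ such that the following holds for every dimension $d\ge 1$, every $\varepsilon\in(0,1)$ and every $\delta\in(0,1)$. Let $\mathcal G_1^d=\{\mathcal N(\mu,I_d):\mu\in\mathbb R^d\}$ and, for $\alpha,\beta,\gamma\in(0,1)$, put \[ L(\alpha,\gamma)=\Bigl(\frac{C\,d}{(1-\gamma)\alpha}\Bigr)^d,\qquad m(\beta,\gamma)=\frac{C\,d\log\bigl(d/(\beta\delta)\bigr)}{(1-\gamma)\varepsilon}. \] There is a randomized algorithm $\mathcal A$ that takes parameters $\alpha,\beta,\gamma\in(0,1)$ and a dataset $D\in(\mathbb R^d)^n$ of any size $n\ge1$, outputs a finite set of probability distributions on $\mathbb R^d$, and has the following properties for all $\alpha,\beta,\gamma\in(0,1)$. 1. (Privacy.) For every $n\ge 1$, all $D,D'\in(\mathbb R^d)^n$ that differ in at most one data point, and every set $S$ of possible outputs, \[\Pr[\mathcal A(\alpha,\beta,\gamma,D)\in S]\le e^{\varepsilon}\Pr[\mathcal A(\alpha,\beta,\gamma,D')\in S]+\delta .\] 2. (List-decoding.) Let $n\ge 1$ be a number of samples with $\delta<1/n$ and $n\ge m(\beta,\gamma)$.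 Then for every dataset $D\in(\mathbb R^d)^n$ the output has, almost surely, at most $L(\alpha,\gamma)$ elements. Moreover, let $f\in\mathcal G_1^d$ and $g=(1-\gamma)f+\gamma h$, where $h$ is an arbitrary probability distribution on $\mathbb R^d$. If $D$ consists of $n$ i.i.d. samples from $g$ and $\widetilde{\mathcal F}$ denotes the output, then with probability at least $1-\beta$ (over the samples and the randomness of the algorithm) \[\inf_{\tilde f\in\widetilde{\mathcal F}} d_{\mathrm{TV}}(f,\tilde f)\le\alpha,\] where $d_{\mathrm{TV}}(f,\tilde f)=\sup_{S}|f(S)-\tilde f(S)|$ over Borel sets $S$ and the infimum over the empty set is $+\infty$. -/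

import Mathlib

open MeasureTheory ProbabilityTheory
open scoped ENNReal

namespace PrivateListDecoding

/-- Total variation distance `sup_S |P_f(S) - P_g(S)|` over measurable `S`. -/
noncomputable def tvDist {X : Type*} [MeasurableSpace X] (f g : ProbabilityMeasure X) : ℝ :=
  ⨆ S : {S : Set X // MeasurableSet S},
    |(f : Measure X).real S.1 - (g : Measure X).real S.1|

/-- A finite set of distributions on `X`, the kind of object a list-decodable learner outputs. -/
structure DistList (X : Type*) [MeasurableSpace X] where
  elems : Finset (ProbabilityMeasure X)

/-- Every set of outputs counts as an event. Privacy and accuracy for this σ-algebra imply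
privacy and accuracy for any other choice of σ-algebra on the output space. -/
instance (X : Type*) [MeasurableSpace X] : MeasurableSpace (DistList X) := ⊤

/-- Distance `inf_{f' ∈ 𝓕} d_TV(f, f')` from a distribution to a set of distributions; the infimum
is taken in `[0, ∞]`, so that the distance to the empty set is `∞`. -/
noncomputable def tvDistToSet {X : Type*} [MeasurableSpace X] (f : ProbabilityMeasure X)
    (F : Set (ProbabilityMeasure X)) : ℝ≥0∞ :=
  ⨅ f' ∈ F, ENNReal.ofReal (tvDist f f')

/-- The `γ`-corrupted distributions of `f`: all `(1 - γ) f + γ h` with `h` an arbitrary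
probability distribution. -/
def corrupted {X : Type*} [MeasurableSpace X] (γ : ℝ) (f : ProbabilityMeasure X) :
    Set (ProbabilityMeasure X) :=
  {g | ∃ h : ProbabilityMeasure X,
    (g : Measure X) = ENNReal.ofReal (1 - γ) • (f : Measure X)
      + ENNReal.ofReal γ • (h : Measure X)}

/-- A randomized algorithm on datasets of arbitrary finite size over `X` with outputs in `Y`:
`law n D` is the distribution of the output on the dataset `D` of size `n`. -/
structure RandomizedAlgorithm (X Y : Type*) [MeasurableSpace X] [MeasurableSpace Y] where
  law : ∀ n : ℕ, Kernel (Fin n → X) Y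
  isMarkov : ∀ n : ℕ, IsMarkovKernel (law n)

/-- Two datasets of the same size are neighbours if they differ in at most one data point. -/
def Neighbours {X : Type*} {n : ℕ} (D D' : Fin n → X) : Prop :=
  {i | D i ≠ D' i}.ncard ≤ 1

/-- `(ε, δ)`-differential privacy. -/
def IsDP {X Y : Type*} [MeasurableSpace X] [MeasurableSpace Y] (ε δ : ℝ)
    (T : RandomizedAlgorithm X Y) : Prop :=
  ∀ n : ℕ, 1 ≤ n → ∀ D D' : Fin n → X, Neighbours D D' → ∀ S : Set Y, MeasurableSet S →
    T.law n D S ≤ ENNReal.ofReal (Real.exp ε) * T.law n D' S + ENNReal.ofReal δ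

/-- The algorithm `A`, which gets the parameters `α, β, γ` as inputs, is an `L`-list-decodable
learner for the class `F` using `m(α, β, γ)` samples, when the number `n` of samples ranges over
the set `sizes` of admissible sample sizes. The bound on the length of the output list holds for
every dataset, almost surely over the algorithm's coins. The success probability is over the
`n` i.i.d. samples from `g` and the algorithm's coins. -/
def IsListDecodableLearner {X : Type*} [MeasurableSpace X]
    (A : ℝ → ℝ → ℝ → RandomizedAlgorithm X (DistList X))
    (F : Set (ProbabilityMeasure X)) (L m : ℝ → ℝ → ℝ → ℝ) (sizes : Set ℕ) : Prop :=
  ∀ α ∈ Set.Ioo (0 : ℝ) 1, ∀ β ∈ Set.Ioo (0 : ℝ) 1, ∀ γ ∈ Set.Ioo (0 : ℝ) 1,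
    ∀ n ∈ sizes, m α β γ ≤ (n : ℝ) →
      (∀ D : Fin n → X, ∀ᵐ l ∂((A α β γ).law n D), (l.elems.card : ℝ) ≤ L α β γ) ∧
      ∀ f ∈ F, ∀ g ∈ corrupted γ f,
        ENNReal.ofReal (1 - β) ≤
          (Measure.pi (fun _ : Fin n => (g : Measure X))).bind ((A α β γ).law n)
            {l | tvDistToSet f (l.elems : Set (ProbabilityMeasure X)) ≤ ENNReal.ofReal α}

/-- `A` is an `(ε, δ)`-DP `L`-list-decodable learner for `F` using `m(α, β, γ)` samples, when the
number of samples ranges over `sizes`. Privacy is required for datasets of every size. -/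
def IsDPListDecodableLearner {X : Type*} [MeasurableSpace X] (ε δ : ℝ)
    (A : ℝ → ℝ → ℝ → RandomizedAlgorithm X (DistList X))
    (F : Set (ProbabilityMeasure X)) (L m : ℝ → ℝ → ℝ → ℝ) (sizes : Set ℕ) : Prop :=
  IsListDecodableLearner A F L m sizes ∧
    ∀ α ∈ Set.Ioo (0 : ℝ) 1, ∀ β ∈ Set.Ioo (0 : ℝ) 1, ∀ γ ∈ Set.Ioo (0 : ℝ) 1,
      IsDP ε δ (A α β γ)

/-- The class of Gaussians `N(μ, I)` on `ℝ^d`, with `μ` arbitrary. -/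
def identityGaussians (d : ℕ) : Set (ProbabilityMeasure (EuclideanSpace ℝ (Fin d))) :=
  {P | ∃ μ : EuclideanSpace ℝ (Fin d),
    (P : Measure (EuclideanSpace ℝ (Fin d))) = multivariateGaussian μ 1}

end PrivateListDecoding

/-! The learner works coordinate by coordinate with a private histogram. A unit Gaussian puts mass
at least `1/5` on the interval `[2j, 2j + 2)` containing its mean, so under `g` the true cell of
each coordinate has mass at least `(1 - γ)/5`. By Chernoff it holds at least `(1 - γ)n/20` points,
except with probability `β` over all coordinates. Cells are selected independently with a
probability depending on their count, equal to 0 up to `(1 - γ)n/80` and to 1 from `(1 - γ)n/20` on.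
Hence at most `80/(1 - γ)` cells per coordinate are ever selected. A grid of width `α/d` in each
selected cell and all combinations of coordinates give the list; it suffices since `d_TV(N(μ, I),
N(ν, I)) ≤ ∑ |μ i - ν i|` (`tvDist_gaussianPM_le`).

Changing a data point moves the counts of at most `2d` cells by one. Each selection is `(ε/(2d),
δ/(6d))`-indistinguishable (`bernoulliClose_selectProb`), and basic composition
(`subsetExp_le_of_bernoulliClose`) gives privacy; decoding is post-processing.

The case `n = 1` is separate: `δ < 1/n` then does not keep `log (d/(βδ))` away from 0, and the
sample bound only forces `d = 1` and `β`, `δ` close to 1. -/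

namespace PrivateListDecoding

/-! ### Random subsets with independent membership, and their composition. -/

section RandomSubset

variable {ι : Type*} [DecidableEq ι]

/-- Probability of the subset `s` of `B` when each `b ∈ B` is selected independently with
probability `p b`. -/
noncomputable def subsetWeight (B : Finset ι) (p : ι → ℝ) (s : Finset ι) : ℝ :=
  (∏ b ∈ s, p b) * ∏ b ∈ B \ s, (1 - p b)

/-- Expectation of `φ` of a random subset of `B` containing each `b ∈ B` independently with
probability `p b`. -/
noncomputable def subsetExp (B : Finset ι) (p : ι → ℝ) (φ : Finset ι → ℝ) : ℝ :=
  ∑ s ∈ B.powerset, subsetWeight B p s * φ s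

lemma subsetWeight_nonneg {B : Finset ι} {p : ι → ℝ} (hp : ∀ b, p b ∈ Set.Icc (0 : ℝ) 1)
    (s : Finset ι) : 0 ≤ subsetWeight B p s :=
  mul_nonneg (Finset.prod_nonneg fun b _ => (hp b).1)
    (Finset.prod_nonneg fun b _ => sub_nonneg.2 (hp b).2)

/-- Conditioning on whether `b` is selected; the inductions on `B` rest on this. -/
lemma subsetExp_insert {B : Finset ι} {b : ι} (hb : b ∉ B) (p : ι → ℝ) (φ : Finset ι → ℝ) :
    subsetExp (insert b B) p φ =
      p b * subsetExp B p (fun s => φ (insert b s)) + (1 - p b) * subsetExp B p φ := by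
  unfold subsetExp
  rw [Finset.sum_powerset_insert hb, add_comm, Finset.mul_sum, Finset.mul_sum]
  congr 1
  · refine Finset.sum_congr rfl fun s hs => ?_
    have hbs : b ∉ s := fun h => hb (Finset.mem_powerset.1 hs h)
    have h : insert b B \ insert b s = B \ s := by
      ext x
      simp only [Finset.mem_sdiff, Finset.mem_insert]
      constructor
      · tauto
      · rintro ⟨h1, h2⟩
        exact ⟨.inr h1, fun h => h.elim (fun e => hb (e ▸ h1)) h2⟩
    rw [subsetWeight, subsetWeight, Finset.prod_insert hbs, h]
    ring
  · refine Finset.sum_congr rfl fun s hs => ?_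
    have hbs : b ∉ s := fun h => hb (Finset.mem_powerset.1 hs h)
    rw [subsetWeight, subsetWeight, Finset.insert_sdiff_of_notMem _ hbs,
      Finset.prod_insert (by simp [hb])]
    ring

lemma subsetExp_one (B : Finset ι) (p : ι → ℝ) : subsetExp B p (fun _ => 1) = 1 := by
  induction B using Finset.induction_on with
  | empty => simp [subsetExp, subsetWeight]
  | insert b B hb ih => rw [subsetExp_insert hb, ih]; ring

lemma subsetExp_mono {B : Finset ι} {p : ι → ℝ} (hp : ∀ b, p b ∈ Set.Icc (0 : ℝ) 1)
    {φ ψ : Finset ι → ℝ} (h : ∀ s, φ s ≤ ψ s) : subsetExp B p φ ≤ subsetExp B p ψ :=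
  Finset.sum_le_sum fun s _ => mul_le_mul_of_nonneg_left (h s) (subsetWeight_nonneg hp s)

lemma subsetExp_mem_Icc {B : Finset ι} {p : ι → ℝ} (hp : ∀ b, p b ∈ Set.Icc (0 : ℝ) 1)
    {φ : Finset ι → ℝ} (h : ∀ s, φ s ∈ Set.Icc (0 : ℝ) 1) :
    subsetExp B p φ ∈ Set.Icc (0 : ℝ) 1 :=
  ⟨Finset.sum_nonneg fun s _ => mul_nonneg (subsetWeight_nonneg hp s) (h s).1,
    (subsetExp_mono hp fun s => (h s).2).trans (subsetExp_one B p).le⟩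

/-- The random subset contains only elements of positive probability, and contains all elements of
probability one. -/
lemma subsetExp_congr {B : Finset ι} {p : ι → ℝ} {φ ψ : Finset ι → ℝ}
    (h : ∀ s, s ⊆ B → (∀ b ∈ s, p b ≠ 0) → (∀ b ∈ B, p b = 1 → b ∈ s) → φ s = ψ s) :
    subsetExp B p φ = subsetExp B p ψ := by
  refine Finset.sum_congr rfl fun s hs => ?_
  by_cases h1 : ∀ b ∈ s, p b ≠ 0
  · by_cases h2 : ∀ b ∈ B, p b = 1 → b ∈ s
    · rw [h s (Finset.mem_powerset.1 hs) h1 h2]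
    · push Not at h2
      obtain ⟨b, hb, hpb, hbs⟩ := h2
      have : subsetWeight B p s = 0 := by
        rw [subsetWeight, Finset.prod_eq_zero (i := b) (s := B \ s) (by simp [hb, hbs])
          (by simp [hpb]), mul_zero]
      simp [this]
  · push Not at h1
    obtain ⟨b, hb, hpb⟩ := h1
    have : subsetWeight B p s = 0 := by
      rw [subsetWeight, Finset.prod_eq_zero hb hpb, zero_mul]
    simp [this]

/-- Allows two datasets with different occupied cells to be compared over one common index set. -/
lemma subsetExp_union {B T : Finset ι} {p : ι → ℝ} (h : ∀ b, b ∉ B → p b = 0)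
    (φ : Finset ι → ℝ) : subsetExp (B ∪ T) p φ = subsetExp B p φ := by
  induction T using Finset.induction_on with
  | empty => simp
  | insert b T _ ih =>
    rw [Finset.union_insert]
    by_cases hb : b ∈ B ∪ T
    · rw [Finset.insert_eq_of_mem hb, ih]
    · rw [subsetExp_insert hb, h b (fun hB => hb (Finset.mem_union_left _ hB)), ih]
      ring

lemma le_subsetExp_of_mem {B : Finset ι} {p : ι → ℝ} (hp : ∀ b, p b ∈ Set.Icc (0 : ℝ) 1)
    {φ : Finset ι → ℝ} (hφ : ∀ s, φ s ∈ Set.Icc (0 : ℝ) 1) {b : ι} (hb : b ∈ B)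
    (h : ∀ s, b ∈ s → φ s = 1) : p b ≤ subsetExp B p φ := by
  rw [← Finset.insert_erase hb, subsetExp_insert (Finset.notMem_erase b B)]
  have h1 : (fun s => φ (insert b s)) = fun _ => 1 :=
    funext fun s => h _ (Finset.mem_insert_self b s)
  rw [h1, subsetExp_one]
  nlinarith [(hp b).2, (subsetExp_mem_Icc (B := B.erase b) hp hφ).1]

/-- `(ε, δ)`-indistinguishability of two Bernoulli parameters, in one direction. -/
def BernoulliClose (ε δ p q : ℝ) : Prop :=
  p ≤ Real.exp ε * q + δ ∧ 1 - p ≤ Real.exp ε * (1 - q) + δ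

lemma BernoulliClose.refl (q : ℝ) : BernoulliClose 0 0 q q := by
  constructor <;> simp

/-- The mixture is the smaller of `x`, `y` plus a multiple of their gap. The weight of that gap is
`p` or `1 - p`, so one of the two inequalities of `BernoulliClose` applies, and the gap is at most
1. -/
lemma BernoulliClose.mix_le {ε δ p q x y : ℝ} (h : BernoulliClose ε δ p q) (hε : 0 ≤ ε)
    (hδ : 0 ≤ δ) (hx : x ∈ Set.Icc (0 : ℝ) 1) (hy : y ∈ Set.Icc (0 : ℝ) 1) :
    p * x + (1 - p) * y ≤ Real.exp ε * (q * x + (1 - q) * y) + δ := by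
  have he : 1 ≤ Real.exp ε := Real.one_le_exp hε
  obtain ⟨h1, h2⟩ := h
  obtain ⟨hx0, hx1⟩ := hx
  obtain ⟨hy0, hy1⟩ := hy
  rcases le_total y x with hyx | hxy
  · have a1 := mul_le_mul_of_nonneg_right h1 (sub_nonneg.2 hyx)
    have a2 := mul_le_mul_of_nonneg_right he hy0
    have a3 : δ * (x - y) ≤ δ * 1 := mul_le_mul_of_nonneg_left (by linarith) hδ
    nlinarith
  · have a1 := mul_le_mul_of_nonneg_right h2 (sub_nonneg.2 hxy)
    have a2 := mul_le_mul_of_nonneg_right he hx0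
    have a3 : δ * (y - x) ≤ δ * 1 := mul_le_mul_of_nonneg_left (by linarith) hδ
    nlinarith

/-- Basic composition for random subsets. -/
lemma subsetExp_le_of_bernoulliClose {p q e δ : ι → ℝ} {K : ℝ}
    (hp : ∀ b, p b ∈ Set.Icc (0 : ℝ) 1) (hq : ∀ b, q b ∈ Set.Icc (0 : ℝ) 1)
    (he : ∀ b, 0 ≤ e b) (hδ : ∀ b, 0 ≤ δ b) (h : ∀ b, BernoulliClose (e b) (δ b) (p b) (q b))
    (B : Finset ι) (hK : Real.exp (∑ b ∈ B, e b) ≤ K) {φ : Finset ι → ℝ}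
    (hφ : ∀ s, φ s ∈ Set.Icc (0 : ℝ) 1) :
    subsetExp B p φ ≤ Real.exp (∑ b ∈ B, e b) * subsetExp B q φ + K * ∑ b ∈ B, δ b := by
  induction B using Finset.induction_on generalizing φ with
  | empty => simp [subsetExp, subsetWeight]
  | insert b B hb ih =>
    rw [Finset.sum_insert hb, Real.exp_add] at hK
    have hM : Real.exp (∑ b ∈ B, e b) ≤ K :=
      (le_mul_of_one_le_left (Real.exp_pos _).le (Real.one_le_exp (he b))).trans hK
    have i1 := ih hM (φ := fun s => φ (insert b s)) fun s => hφ _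
    have i0 := ih hM hφ
    have m1 := subsetExp_mem_Icc (B := B) hq (φ := fun s => φ (insert b s)) fun s => hφ _
    have m0 := subsetExp_mem_Icc (B := B) hq hφ
    rw [subsetExp_insert hb, subsetExp_insert hb, Finset.sum_insert hb, Finset.sum_insert hb,
      Real.exp_add]
    set M := Real.exp (∑ b ∈ B, e b)
    set x := subsetExp B q fun s => φ (insert b s)
    set y := subsetExp B q φ
    have hMpos : 0 < M := Real.exp_pos _
    have j1 := mul_le_mul_of_nonneg_left i1 (hp b).1
    have j0 := mul_le_mul_of_nonneg_left i0 (sub_nonneg.2 (hp b).2)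
    have k := mul_le_mul_of_nonneg_left ((h b).mix_le (he b) (hδ b) m1 m0) hMpos.le
    -- The additive error of `b` is amplified by the factor `M` of the other elements, which `K`
    -- bounds.
    have l := mul_le_mul_of_nonneg_right hM (hδ b)
    nlinarith

end RandomSubset

/-! ### The random subset as a probability measure. -/

section RandomSubsetLaw

variable {ι Y : Type*} [DecidableEq ι] [MeasurableSpace Y]

/-- Law of `f s` for a random subset `s` of `B` containing each `b ∈ B` independently with
probability `p b`. -/
noncomputable def subsetLaw (B : Finset ι) (p : ι → ℝ) (f : Finset ι → Y) : Measure Y :=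
  ∑ s ∈ B.powerset, ENNReal.ofReal (subsetWeight B p s) • Measure.dirac (f s)

lemma subsetLaw_apply {B : Finset ι} {p : ι → ℝ} (hp : ∀ b, p b ∈ Set.Icc (0 : ℝ) 1)
    (f : Finset ι → Y) {S : Set Y} (hS : MeasurableSet S) :
    subsetLaw B p f S = ENNReal.ofReal (subsetExp B p ((f ⁻¹' S).indicator 1)) := by
  rw [subsetLaw, subsetExp, Measure.finsetSum_apply, ENNReal.ofReal_sum_of_nonneg]
  · refine Finset.sum_congr rfl fun s _ => ?_
    rw [Measure.smul_apply, Measure.dirac_apply' _ hS, smul_eq_mul,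
      ENNReal.ofReal_mul (subsetWeight_nonneg hp s)]
    by_cases h : f s ∈ S <;> simp [h]
  · intro s _
    exact mul_nonneg (subsetWeight_nonneg hp s) (Set.indicator_nonneg (fun _ _ => zero_le_one) _)

lemma isProbabilityMeasure_subsetLaw {B : Finset ι} {p : ι → ℝ}
    (hp : ∀ b, p b ∈ Set.Icc (0 : ℝ) 1) (f : Finset ι → Y) :
    IsProbabilityMeasure (subsetLaw B p f) := by
  constructor
  rw [subsetLaw_apply hp f MeasurableSet.univ, Set.preimage_univ, Set.indicator_univ]
  exact (congrArg ENNReal.ofReal (subsetExp_one B p)).trans ENNReal.ofReal_one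

lemma indicator_one_mem_Icc {α : Type*} (A : Set α) (a : α) :
    A.indicator (1 : α → ℝ) a ∈ Set.Icc (0 : ℝ) 1 := by
  by_cases h : a ∈ A <;> simp [h]

/-- Events that hold for all subsets of positive weight hold with probability one. -/
lemma subsetLaw_eq_one {B : Finset ι} {p : ι → ℝ} (hp : ∀ b, p b ∈ Set.Icc (0 : ℝ) 1)
    (f : Finset ι → Y) {S : Set Y} (hS : MeasurableSet S)
    (h : ∀ s, s ⊆ B → (∀ b ∈ s, p b ≠ 0) → (∀ b ∈ B, p b = 1 → b ∈ s) → f s ∈ S) :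
    subsetLaw B p f S = 1 := by
  rw [subsetLaw_apply hp f hS, subsetExp_congr (ψ := fun _ => 1), subsetExp_one,
    ENNReal.ofReal_one]
  intro s h1 h2 h3
  exact Set.indicator_of_mem (s := f ⁻¹' S) (h s h1 h2 h3) (1 : Finset ι → ℝ)

lemma le_subsetLaw {B : Finset ι} {p : ι → ℝ} (hp : ∀ b, p b ∈ Set.Icc (0 : ℝ) 1)
    (f : Finset ι → Y) {S : Set Y} (hS : MeasurableSet S) {b : ι} (hb : b ∈ B)
    (h : ∀ s, b ∈ s → f s ∈ S) : ENNReal.ofReal (p b) ≤ subsetLaw B p f S := by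
  rw [subsetLaw_apply hp f hS]
  refine ENNReal.ofReal_le_ofReal (le_subsetExp_of_mem hp (indicator_one_mem_Icc _) hb ?_)
  exact fun s hs => Set.indicator_of_mem (s := f ⁻¹' S) (h s hs) (1 : Finset ι → ℝ)

end RandomSubsetLaw

/-! ### Histogram cells and privacy of their selection. -/

section Histogram

/-- The cells `(i, j)` such that the `i`-th coordinate of some data point is `j`. -/
def cells {n d : ℕ} (Z : Fin n → Fin d → ℤ) : Finset (Fin d × ℤ) :=
  Finset.univ.image fun a : Fin n × Fin d => (a.2, Z a.1 a.2)

/-- The number of data points whose coordinate `b.1` is `b.2`. -/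
def cellCount {n d : ℕ} (Z : Fin n → Fin d → ℤ) (b : Fin d × ℤ) : ℕ :=
  (Finset.univ.filter fun k => Z k b.1 = b.2).card

lemma cellCount_eq_zero {n d : ℕ} {Z : Fin n → Fin d → ℤ} {b : Fin d × ℤ} (hb : b ∉ cells Z) :
    cellCount Z b = 0 := by
  rw [cellCount, Finset.card_eq_zero, Finset.filter_eq_empty_iff]
  rintro k - hk
  exact hb (Finset.mem_image.2 ⟨(k, b.1), Finset.mem_univ _, by rw [hk]⟩)

lemma cellCount_le_succ {n d : ℕ} {Z Z' : Fin n → Fin d → ℤ} {k₀ : Fin n}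
    (h : ∀ k, k ≠ k₀ → Z k = Z' k) (b : Fin d × ℤ) : cellCount Z b ≤ cellCount Z' b + 1 := by
  classical
  unfold cellCount
  calc _ ≤ (insert k₀ (Finset.univ.filter fun k => Z' k b.1 = b.2)).card := by
        refine Finset.card_le_card fun k hk => ?_
        by_cases hkk : k = k₀
        · simp [hkk]
        · simpa [hkk, ← h k hkk] using hk
    _ ≤ _ := Finset.card_insert_le _ _

lemma cellCount_congr {n d : ℕ} {Z Z' : Fin n → Fin d → ℤ} {k₀ : Fin n}
    (h : ∀ k, k ≠ k₀ → Z k = Z' k) {b : Fin d × ℤ} (h1 : Z k₀ b.1 ≠ b.2) (h2 : Z' k₀ b.1 ≠ b.2) :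
    cellCount Z b = cellCount Z' b := by
  unfold cellCount
  congr 1
  ext k
  by_cases hkk : k = k₀
  · simp [hkk, h1, h2]
  · simp [h k hkk]

lemma sum_cellCount_le {n d : ℕ} (Z : Fin n → Fin d → ℤ) (i : Fin d) (s : Finset (Fin d × ℤ))
    (hs : ∀ b ∈ s, b.1 = i) : ∑ b ∈ s, cellCount Z b ≤ n := by
  have h : ∀ b ∈ s, cellCount Z b = (Finset.univ.filter fun k => (i, Z k i) = b).card := by
    intro b hb
    unfold cellCount
    congr 1
    ext k
    obtain rfl := hs b hb
    simp [Prod.ext_iff]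
  rw [Finset.sum_congr rfl h]
  rw [Finset.sum_card_fiberwise_eq_card_filter]
  exact (Finset.card_filter_le _ _).trans (by simp)

/-- Privacy of the random selection of histogram cells. -/
lemma subsetExp_cells_le {n d : ℕ} (hd : 1 ≤ d) {ε δ : ℝ} (hε : ε ∈ Set.Ioo (0 : ℝ) 1)
    (hδ : 0 ≤ δ) {pr : ℕ → ℝ} (hpr : ∀ k, pr k ∈ Set.Icc (0 : ℝ) 1) (h0 : pr 0 = 0)
    (hclose : ∀ k l, k ≤ l + 1 → l ≤ k + 1 →
      BernoulliClose (ε / (2 * d)) (δ / (6 * d)) (pr k) (pr l))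
    {Z Z' : Fin n → Fin d → ℤ} {k₀ : Fin n} (h : ∀ k, k ≠ k₀ → Z k = Z' k)
    {φ : Finset (Fin d × ℤ) → ℝ} (hφ : ∀ s, φ s ∈ Set.Icc (0 : ℝ) 1) :
    subsetExp (cells Z) (fun b => pr (cellCount Z b)) φ ≤
      Real.exp ε * subsetExp (cells Z') (fun b => pr (cellCount Z' b)) φ + δ := by
  classical
  have hd' : (0 : ℝ) < d := by exact_mod_cast hd
  -- The only cells whose count can change: those occupied by point `k₀` before or after, two per
  -- coordinate.
  let T : Finset (Fin d × ℤ) :=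
    (Finset.univ.image fun i => (i, Z k₀ i)) ∪ Finset.univ.image fun i => (i, Z' k₀ i)
  have hT : (T.card : ℝ) ≤ 2 * d := by
    have h1 : T.card ≤ d + d := (Finset.card_union_le _ _).trans <| add_le_add
      (Finset.card_image_le.trans (by simp)) (Finset.card_image_le.trans (by simp))
    have h2 : (T.card : ℝ) ≤ d + d := by exact_mod_cast h1
    linarith
  rw [← subsetExp_union (T := cells Z') (fun b hb => by rw [cellCount_eq_zero hb, h0]),
    ← subsetExp_union (B := cells Z') (T := cells Z) (fun b hb => by rw [cellCount_eq_zero hb, h0]),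
    Finset.union_comm (cells Z')]
  set B := cells Z ∪ cells Z'
  have hsum : ∀ c : ℝ, 0 ≤ c → ∑ b ∈ B, (if b ∈ T then c else 0) ≤ 2 * d * c := by
    intro c hc
    rw [← Finset.sum_filter, Finset.sum_const, nsmul_eq_mul]
    refine mul_le_mul_of_nonneg_right (le_trans ?_ hT) hc
    exact_mod_cast Finset.card_le_card fun b hb => (Finset.mem_filter.1 hb).2
  have he := hsum (ε / (2 * d)) (div_nonneg hε.1.le (by positivity))
  rw [mul_div_cancel₀ _ (by positivity)] at he
  have hδ2 := hsum (δ / (6 * d)) (by positivity)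
  -- Here `K = 3` works because `exp ε ≤ e < 3`, and the additive errors sum to at most `3 · 2d ·
  -- δ/(6d) = δ`.
  have key := subsetExp_le_of_bernoulliClose (p := fun b => pr (cellCount Z b))
    (q := fun b => pr (cellCount Z' b)) (e := fun b => if b ∈ T then ε / (2 * d) else 0)
    (δ := fun b => if b ∈ T then δ / (6 * d) else 0) (K := 3) (fun _ => hpr _) (fun _ => hpr _)
    (fun b => by split_ifs <;> [exact div_nonneg hε.1.le (by positivity); exact le_rfl])
    (fun b => by split_ifs <;> positivity)
    (fun b => by
      by_cases hb : b ∈ T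
      · simp only [hb, if_true]
        exact hclose _ _ (cellCount_le_succ h b) (cellCount_le_succ (fun k hk => (h k hk).symm) b)
      · simp only [hb, if_false]
        have hb' : Z k₀ b.1 ≠ b.2 ∧ Z' k₀ b.1 ≠ b.2 := by
          constructor <;> intro e <;> apply hb <;> simp only [T, Finset.mem_union, Finset.mem_image]
          · exact .inl ⟨b.1, Finset.mem_univ _, by rw [e]⟩
          · exact .inr ⟨b.1, Finset.mem_univ _, by rw [e]⟩
        rw [cellCount_congr h hb'.1 hb'.2]
        exact BernoulliClose.refl _)
    B (((Real.exp_le_exp.2 (he.trans hε.2.le)).trans (Real.exp_one_lt_d9.le)).trans (by norm_num))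
    hφ
  refine key.trans (add_le_add (mul_le_mul_of_nonneg_right (Real.exp_le_exp.2 he)
    (subsetExp_mem_Icc (fun _ => hpr _) hφ).1) ?_)
  calc (3 : ℝ) * _ ≤ 3 * (2 * d * (δ / (6 * d))) := mul_le_mul_of_nonneg_left hδ2 (by norm_num)
    _ = δ := by field_simp; ring

end Histogram

/-! ### The selection probability as a function of the count. -/

section SelectionProbability

lemma sigmoid_le_exp_mul {a x y : ℝ} (ha : 0 ≤ a) (h : x ≤ y + a) :
    Real.sigmoid x ≤ Real.exp a * Real.sigmoid y := by
  rw [Real.sigmoid_def, Real.sigmoid_def, ← div_eq_mul_inv, inv_eq_one_div,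
    div_le_div_iff₀ (by positivity) (by positivity), one_mul, mul_add, mul_one, ← Real.exp_add]
  exact add_le_add (Real.one_le_exp ha) (Real.exp_le_exp.2 (by linarith))

lemma sigmoid_neg_le_exp (x : ℝ) : Real.sigmoid (-x) ≤ Real.exp (-x) := by
  rw [Real.sigmoid_def, neg_neg]
  have h : 0 < Real.exp x := Real.exp_pos x
  rw [Real.exp_neg]
  exact inv_anti₀ h (by linarith)

/-- A sigmoid stretched vertically by `s` at both ends and truncated to `[0, 1]`. -/
noncomputable def clampedSigmoid (s x : ℝ) : ℝ :=
  max 0 (min 1 ((1 + 2 * s) * Real.sigmoid x - s))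

lemma clampedSigmoid_mem_Icc (s x : ℝ) : clampedSigmoid s x ∈ Set.Icc (0 : ℝ) 1 :=
  ⟨le_max_left _ _, max_le zero_le_one (min_le_left _ _)⟩

lemma one_sub_clampedSigmoid (s x : ℝ) : 1 - clampedSigmoid s x = clampedSigmoid s (-x) := by
  have h : (1 + 2 * s) * Real.sigmoid (-x) - s = 1 - ((1 + 2 * s) * Real.sigmoid x - s) := by
    rw [Real.sigmoid_neg]; ring
  unfold clampedSigmoid
  rw [h]
  generalize (1 + 2 * s) * Real.sigmoid x - s = u
  rcases le_total u 0 with h1 | h1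
  · rw [min_eq_right (by linarith), max_eq_left h1, min_eq_left (by linarith)]; simp
  · rcases le_total u 1 with h2 | h2
    · rw [min_eq_right h2, max_eq_right h1, min_eq_right (by linarith), max_eq_right (by linarith)]
    · rw [min_eq_left h2, min_eq_right (by linarith), max_eq_left (by linarith : 1 - u ≤ 0)]; simp

/-- The stretched sigmoid keeps the multiplicative bound `exp a`. Subtracting `s` costs `(exp a - 1)
s ≤ 2s`, since `exp a ≤ 3`. -/
lemma clampedSigmoid_le {s a x y : ℝ} (hs : 0 ≤ s) (ha : 0 ≤ a) (ha1 : a ≤ 1) (h : x ≤ y + a) :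
    clampedSigmoid s x ≤ Real.exp a * clampedSigmoid s y + 2 * s := by
  have h1 : 1 ≤ Real.exp a := Real.one_le_exp ha
  have h3 : Real.exp a ≤ 3 :=
    ((Real.exp_le_exp.2 ha1).trans Real.exp_one_lt_d9.le).trans (by norm_num)
  have h2 := mul_le_mul_of_nonneg_left (sigmoid_le_exp_mul ha h) (by linarith : 0 ≤ 1 + 2 * s)
  unfold clampedSigmoid
  refine max_le (by positivity) ?_
  rcases le_total ((1 + 2 * s) * Real.sigmoid y - s) 1 with hy | hy
  · rw [min_eq_right hy]
    refine (min_le_right _ _).trans ?_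
    have := mul_le_mul_of_nonneg_left (le_max_right 0 ((1 + 2 * s) * Real.sigmoid y - s))
      (by linarith : 0 ≤ Real.exp a)
    nlinarith
  · rw [min_eq_left hy, max_eq_right zero_le_one]
    exact (min_le_left _ _).trans (by linarith)

lemma bernoulliClose_clampedSigmoid {s a x y : ℝ} (hs : 0 ≤ s) (ha : 0 ≤ a) (ha1 : a ≤ 1)
    (h1 : x ≤ y + a) (h2 : y ≤ x + a) :
    BernoulliClose a (2 * s) (clampedSigmoid s x) (clampedSigmoid s y) := by
  refine ⟨clampedSigmoid_le hs ha ha1 h1, ?_⟩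
  rw [one_sub_clampedSigmoid, one_sub_clampedSigmoid]
  exact clampedSigmoid_le hs ha ha1 (by linarith)

lemma clampedSigmoid_eq_zero {s x : ℝ} (hs : 0 < s) (hs1 : s ≤ 1 / 2)
    (h : x ≤ -Real.log (2 / s)) : clampedSigmoid s x = 0 := by
  refine max_eq_left ((min_le_right _ _).trans ?_)
  have h1 : Real.sigmoid x ≤ s / 2 := by
    refine (Real.sigmoid_le h).trans ((sigmoid_neg_le_exp _).trans ?_)
    rw [Real.exp_neg, Real.exp_log (by positivity), inv_div]
  have := mul_le_mul_of_nonneg_left h1 (by linarith : 0 ≤ 1 + 2 * s)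
  nlinarith

lemma clampedSigmoid_eq_one {s x : ℝ} (hs : 0 < s) (hs1 : s ≤ 1 / 2)
    (h : Real.log (2 / s) ≤ x) : clampedSigmoid s x = 1 := by
  have h1 := clampedSigmoid_eq_zero hs hs1 (neg_le_neg h)
  rw [← one_sub_clampedSigmoid] at h1
  linarith

/-- Number of data points from which on the selection of a cell is no longer ruled out. -/
noncomputable def lowCount (γ : ℝ) (n : ℕ) : ℝ := (1 - γ) * n / 80

/-- Half the length of the window in which the selection of a cell is random. -/
noncomputable def countSlack (d : ℕ) (ε δ : ℝ) : ℝ := 2 * d / ε * Real.log (24 * d / δ)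

/-- Probability of selecting a cell that contains `k` out of `n` data points. -/
noncomputable def selectProb (d : ℕ) (ε δ γ : ℝ) (n k : ℕ) : ℝ :=
  -- A single sample cannot make a cell heavy; its cells are selected with the probability that the
  -- additive budget per cell allows.
  if n = 1 then (if k = 0 then 0 else δ / (6 * d))
  else clampedSigmoid (δ / (12 * d)) (ε / (2 * d) * (k - (lowCount γ n + countSlack d ε δ)))

variable {d : ℕ} {ε δ γ : ℝ}

lemma selectProb_mem_Icc (hd : 1 ≤ d) (hδ : δ ∈ Set.Ioo (0 : ℝ) 1) (n k : ℕ) :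
    selectProb d ε δ γ n k ∈ Set.Icc (0 : ℝ) 1 := by
  have hd' : (1 : ℝ) ≤ d := by exact_mod_cast hd
  unfold selectProb
  split_ifs
  · simp
  · exact ⟨div_nonneg hδ.1.le (by positivity), by
      rw [div_le_one (by positivity)]; linarith [hδ.2]⟩
  · exact clampedSigmoid_mem_Icc _ _

lemma selectProb_eq_zero (hd : 1 ≤ d) (hε : ε ∈ Set.Ioo (0 : ℝ) 1) (hδ : δ ∈ Set.Ioo (0 : ℝ) 1)
    (hγ : γ ∈ Set.Ioo (0 : ℝ) 1) {n k : ℕ} (h : (k : ℝ) ≤ lowCount γ n) :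
    selectProb d ε δ γ n k = 0 := by
  have hd' : (1 : ℝ) ≤ d := by exact_mod_cast hd
  have hδ0 := hδ.1
  have hε0 := hε.1
  unfold selectProb
  split_ifs with h1 h2
  · rfl
  · exfalso
    have : (1 : ℝ) ≤ k := by exact_mod_cast Nat.one_le_iff_ne_zero.2 h2
    rw [h1, lowCount, Nat.cast_one] at h
    linarith [hγ.1]
  · refine clampedSigmoid_eq_zero (by positivity) ?_ ?_
    · rw [div_le_div_iff₀ (by positivity) (by norm_num)]; linarith [hδ.2]
    -- `countSlack` is chosen so that the sigmoid, of slope parameter `ε/(2d)`, reaches its clamping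
    -- point exactly at the ends of the window.
    · have e : Real.log (2 / (δ / (12 * d))) = ε / (2 * d) * countSlack d ε δ := by
        rw [countSlack, show 2 / (δ / (12 * d)) = 24 * (d : ℝ) / δ by field_simp; norm_num]
        field_simp
      rw [e, ← mul_neg]
      exact mul_le_mul_of_nonneg_left (by linarith) (by positivity)

lemma selectProb_eq_one (hd : 1 ≤ d) (hε : ε ∈ Set.Ioo (0 : ℝ) 1) (hδ : δ ∈ Set.Ioo (0 : ℝ) 1)
    {n k : ℕ} (hn : n ≠ 1) (h : lowCount γ n + 2 * countSlack d ε δ ≤ k) :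
    selectProb d ε δ γ n k = 1 := by
  have hd' : (1 : ℝ) ≤ d := by exact_mod_cast hd
  have hδ0 := hδ.1
  have hε0 := hε.1
  rw [selectProb, if_neg hn]
  refine clampedSigmoid_eq_one (by positivity) ?_ ?_
  · rw [div_le_div_iff₀ (by positivity) (by norm_num)]; linarith [hδ.2]
  · have e : Real.log (2 / (δ / (12 * d))) = ε / (2 * d) * countSlack d ε δ := by
      rw [countSlack, show 2 / (δ / (12 * d)) = 24 * (d : ℝ) / δ by field_simp; norm_num]
      field_simp
    rw [e]
    exact mul_le_mul_of_nonneg_left (by linarith) (by positivity)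

lemma bernoulliClose_selectProb (hd : 1 ≤ d) (hε : ε ∈ Set.Ioo (0 : ℝ) 1)
    (hδ : δ ∈ Set.Ioo (0 : ℝ) 1) (n k l : ℕ) (hkl : k ≤ l + 1) (hlk : l ≤ k + 1) :
    BernoulliClose (ε / (2 * d)) (δ / (6 * d)) (selectProb d ε δ γ n k)
      (selectProb d ε δ γ n l) := by
  have hd' : (1 : ℝ) ≤ d := by exact_mod_cast hd
  have hδ0 := hδ.1
  have hε0 := hε.1
  have ha : 0 ≤ ε / (2 * d) := by positivity
  unfold selectProb
  by_cases h1 : n = 1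
  · simp only [h1, if_true]
    have he : 1 ≤ Real.exp (ε / (2 * d)) := Real.one_le_exp ha
    have h0 : 0 ≤ δ / (6 * d) := by positivity
    have h1 : δ / (6 * d) ≤ 1 := by rw [div_le_one (by positivity)]; linarith [hδ.2]
    split_ifs <;> constructor <;> nlinarith
  · simp only [h1, if_false]
    have e : δ / (6 * d) = 2 * (δ / (12 * d)) := by field_simp; norm_num
    rw [e]
    have c1 : (k : ℝ) ≤ l + 1 := by exact_mod_cast hkl
    have c2 : (l : ℝ) ≤ k + 1 := by exact_mod_cast hlk
    refine bernoulliClose_clampedSigmoid (by positivity) ha ?_ ?_ ?_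
    · rw [div_le_one (by positivity)]; linarith [hε.2]
    · nlinarith
    · nlinarith

end SelectionProbability

/-! ### Subadditivity of total variation over products. -/

section TotalVariation

/-- Hybrid argument through `μ₁.prod ν₂`: one factor is exchanged at a time, slice by slice. -/
lemma prod_le_prod_add {X Y : Type*} [MeasurableSpace X] [MeasurableSpace Y]
    {μ₁ ν₁ : Measure X} {μ₂ ν₂ : Measure Y} [IsProbabilityMeasure μ₁] [IsProbabilityMeasure ν₁]
    [IsProbabilityMeasure μ₂] [IsProbabilityMeasure ν₂] {a b : ℝ≥0∞}
    (h₁ : ∀ S, MeasurableSet S → μ₁ S ≤ ν₁ S + a) (h₂ : ∀ S, MeasurableSet S → μ₂ S ≤ ν₂ S + b)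
    {S : Set (X × Y)} (hS : MeasurableSet S) : μ₁.prod μ₂ S ≤ ν₁.prod ν₂ S + (a + b) := by
  calc μ₁.prod μ₂ S = ∫⁻ x, μ₂ (Prod.mk x ⁻¹' S) ∂μ₁ := Measure.prod_apply hS
    _ ≤ ∫⁻ x, ν₂ (Prod.mk x ⁻¹' S) + b ∂μ₁ :=
        lintegral_mono fun x => h₂ _ (measurable_prodMk_left hS)
    _ = μ₁.prod ν₂ S + b := by
        rw [lintegral_add_right _ measurable_const, Measure.prod_apply hS]; simp
    _ = ∫⁻ y, μ₁ ((fun x => (x, y)) ⁻¹' S) ∂ν₂ + b := by rw [Measure.prod_apply_symm hS]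
    _ ≤ ∫⁻ y, ν₁ ((fun x => (x, y)) ⁻¹' S) + a ∂ν₂ + b :=
        add_le_add_left (lintegral_mono fun y => h₁ _ (measurable_prodMk_right hS)) _
    _ = ν₁.prod ν₂ S + (a + b) := by
        rw [lintegral_add_right _ measurable_const, Measure.prod_apply_symm hS]; simp [add_assoc]

lemma pi_le_pi_add {X : Type*} [MeasurableSpace X] :
    ∀ {d : ℕ} {μ ν : Fin d → Measure X} [∀ i, IsProbabilityMeasure (μ i)]
      [∀ i, IsProbabilityMeasure (ν i)] {a : Fin d → ℝ≥0∞}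
      (_ : ∀ i S, MeasurableSet S → μ i S ≤ ν i S + a i) {S : Set (Fin d → X)}
      (_ : MeasurableSet S), Measure.pi μ S ≤ Measure.pi ν S + ∑ i, a i
  | 0, μ, ν, _, _, a, _, S, _ => by
    rw [show μ = ν from Subsingleton.elim _ _]
    exact le_self_add
  | d + 1, μ, ν, _, _, a, h, S, hS => by
    have e := (MeasurableEquiv.piFinSuccAbove (fun _ : Fin (d + 1) => X) 0).symm.measurable hS
    have hμ := (measurePreserving_piFinSuccAbove μ 0).symm.measure_preimage hS.nullMeasurableSet
    have hν := (measurePreserving_piFinSuccAbove ν 0).symm.measure_preimage hS.nullMeasurableSet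
    rw [← hμ, ← hν, Fin.sum_univ_succ]
    exact prod_le_prod_add (h 0) (fun S hS => pi_le_pi_add (fun i => h _) hS) e

lemma tvDist_le {X : Type*} [MeasurableSpace X] {f g : ProbabilityMeasure X} {c : ℝ} (hc : 0 ≤ c)
    (h₁ : ∀ S, MeasurableSet S → (f : Measure X) S ≤ (g : Measure X) S + ENNReal.ofReal c)
    (h₂ : ∀ S, MeasurableSet S → (g : Measure X) S ≤ (f : Measure X) S + ENNReal.ofReal c) :
    tvDist f g ≤ c := by
  have key : ∀ {μ ν : Measure X} [IsProbabilityMeasure μ] [IsProbabilityMeasure ν] {S : Set X},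
      μ S ≤ ν S + ENNReal.ofReal c → μ.real S ≤ ν.real S + c := by
    intro μ ν _ _ S h
    have := ENNReal.toReal_mono (by finiteness) h
    rwa [ENNReal.toReal_add (by finiteness) (by finiteness), ENNReal.toReal_ofReal hc] at this
  have : Nonempty {S : Set X // MeasurableSet S} := ⟨⟨∅, .empty⟩⟩
  refine ciSup_le fun S => abs_sub_le_iff.2 ⟨?_, ?_⟩
  · linarith [key (h₁ S.1 S.2)]
  · linarith [key (h₂ S.1 S.2)]

/-- Pass to complements; thus one-sided bounds on all events suffice for total variation. -/
lemma measure_le_add_symm {X : Type*} [MeasurableSpace X] {μ ν : Measure X}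
    [IsProbabilityMeasure μ] [IsProbabilityMeasure ν] {a : ℝ≥0∞}
    (h : ∀ S, MeasurableSet S → μ S ≤ ν S + a) {S : Set X} (hS : MeasurableSet S) :
    ν S ≤ μ S + a := by
  have h1 := h Sᶜ hS.compl
  rw [prob_compl_eq_one_sub hS, tsub_le_iff_right, prob_compl_eq_one_sub hS] at h1
  have h2 : ν S + 1 ≤ ν S + (1 - ν S + a + μ S) := add_le_add_right h1 _
  rw [← add_assoc, ← add_assoc, add_tsub_cancel_of_le prob_le_one, add_assoc, add_comm] at h2
  rw [add_comm (μ S)]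
  exact (ENNReal.add_le_add_iff_left ENNReal.one_ne_top).1 h2

end TotalVariation

/-! ### Gaussian estimates: total variation and mass of a bin. -/

section Gaussian

lemma gaussianPDFReal_one_le_one (a x : ℝ) : gaussianPDFReal a 1 x ≤ 1 := by
  unfold gaussianPDFReal
  have h1 : (√(2 * Real.pi * (1 : NNReal)))⁻¹ ≤ 1 := by
    refine inv_le_one_of_one_le₀ (Real.one_le_sqrt.2 ?_)
    simp only [NNReal.coe_one]
    linarith [Real.pi_gt_three]
  have h2 : Real.exp (-(x - a) ^ 2 / (2 * (1 : NNReal))) ≤ 1 := by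
    refine Real.exp_le_one_iff.2 ?_
    rw [neg_div]
    exact neg_nonpos.2 (by positivity)
  exact mul_le_one₀ h1 (Real.exp_pos _).le h2

lemma fifth_le_gaussianPDFReal {a x : ℝ} (h : |x - a| ≤ 1) : 1 / 5 ≤ gaussianPDFReal a 1 x := by
  unfold gaussianPDFReal
  have h1 : √(2 * Real.pi * (1 : NNReal)) ≤ 2.52 := by
    refine Real.sqrt_le_iff.2 ⟨by norm_num, ?_⟩
    simp only [NNReal.coe_one]
    nlinarith [Real.pi_lt_d2]
  have h0 : 0 < √(2 * Real.pi * (1 : NNReal)) := by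
    refine Real.sqrt_pos.2 ?_
    simp only [NNReal.coe_one]
    linarith [Real.pi_gt_three]
  have h2 : 0.6 ≤ Real.exp (-(x - a) ^ 2 / (2 * (1 : NNReal))) := by
    have h3 : (x - a) ^ 2 ≤ 1 := (sq_le_one_iff_abs_le_one _).2 h
    have h4 : 0.6 ≤ Real.exp (-1 / 2) := by
      have h5 : Real.exp (-1 / 2) * Real.exp (-1 / 2) = Real.exp (-1) := by
        rw [← Real.exp_add]; norm_num
      nlinarith [Real.exp_neg_one_gt_d9, Real.exp_pos (-1 / 2)]
    refine h4.trans (Real.exp_le_exp.2 ?_)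
    simp only [NNReal.coe_one]
    linarith
  rw [← div_eq_inv_mul, le_div_iff₀ h0]
  linarith

lemma gaussianReal_le_volume (a : ℝ) (S : Set ℝ) : gaussianReal a 1 S ≤ volume S := by
  rw [gaussianReal_apply a one_ne_zero]
  calc _ ≤ ∫⁻ _ in S, 1 := lintegral_mono fun x =>
        ENNReal.ofReal_le_one.2 (gaussianPDFReal_one_le_one a x)
    _ = volume S := by simp

lemma gaussianReal_le_of_forall_pdf_le {a b : ℝ} {S : Set ℝ} (hS : MeasurableSet S)
    (h : ∀ x ∈ S, gaussianPDFReal a 1 x ≤ gaussianPDFReal b 1 x) :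
    gaussianReal a 1 S ≤ gaussianReal b 1 S := by
  rw [gaussianReal_apply a one_ne_zero, gaussianReal_apply b one_ne_zero]
  exact setLIntegral_mono' hS fun x hx => ENNReal.ofReal_le_ofReal (h x hx)

lemma gaussianPDFReal_le_of_sq_le {a b x : ℝ} (h : (x - b) ^ 2 ≤ (x - a) ^ 2) :
    gaussianPDFReal a 1 x ≤ gaussianPDFReal b 1 x := by
  unfold gaussianPDFReal
  refine mul_le_mul_of_nonneg_left (Real.exp_le_exp.2 ?_) (by positivity)
  simp only [NNReal.coe_one]
  linarith

/-- After translation the two half-lines differ by an interval of length `b - a`, on which the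
density is at most 1. -/
lemma gaussianReal_Iio_le {a b m : ℝ} (hab : a ≤ b) :
    gaussianReal a 1 (Set.Iio m) ≤ gaussianReal b 1 (Set.Iio m) + ENNReal.ofReal (b - a) := by
  have h1 : gaussianReal a 1 (Set.Iio m) = gaussianReal b 1 (Set.Iio (m + (b - a))) := by
    have := gaussianReal_map_add_const (μ := a) (v := 1) (b - a)
    rw [add_sub_cancel] at this
    rw [← this, Measure.map_apply (by fun_prop) measurableSet_Iio]
    congr 1
    ext x
    simp
  rw [h1, ← Set.Iio_union_Ico_eq_Iio (by linarith : m ≤ m + (b - a))]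
  refine (measure_union_le _ _).trans (add_le_add_right ((gaussianReal_le_volume _ _).trans ?_) _)
  rw [Real.volume_Ico, add_sub_cancel_left]

/-- The density at mean `a` is the larger one exactly on the side of `a` of the midpoint `m`. So the
excess mass is greatest on the half-line `Iio m`, which `gaussianReal_Iio_le` handles. -/
lemma gaussianReal_le_add_of_le {a b : ℝ} (hab : a ≤ b) {S : Set ℝ} (hS : MeasurableSet S) :
    gaussianReal a 1 S ≤ gaussianReal b 1 S + ENNReal.ofReal (b - a) := by
  set m := (a + b) / 2 with hm
  have hI : MeasurableSet (Set.Iio m) := measurableSet_Iio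
  have h1 : gaussianReal a 1 (S \ Set.Iio m) ≤ gaussianReal b 1 (S \ Set.Iio m) := by
    refine gaussianReal_le_of_forall_pdf_le (hS.diff hI) fun x hx => gaussianPDFReal_le_of_sq_le ?_
    have : m ≤ x := not_lt.1 hx.2
    nlinarith
  have h2 : gaussianReal b 1 (Set.Iio m \ S) ≤ gaussianReal a 1 (Set.Iio m \ S) := by
    refine gaussianReal_le_of_forall_pdf_le (hI.diff hS) fun x hx => gaussianPDFReal_le_of_sq_le ?_
    have : x < m := hx.1
    nlinarith
  have h3 : gaussianReal a 1 (S ∩ Set.Iio m) ≤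
      gaussianReal b 1 (S ∩ Set.Iio m) + ENNReal.ofReal (b - a) := by
    have h4 := gaussianReal_Iio_le (m := m) hab
    rw [← measure_inter_add_sdiff _ hS, ← measure_inter_add_sdiff (μ := gaussianReal b 1) _ hS,
      Set.inter_comm] at h4
    have h5 := (add_le_add_right h2 (gaussianReal a 1 (S ∩ Set.Iio m))).trans h4
    rw [add_right_comm] at h5
    exact (ENNReal.add_le_add_iff_right (measure_ne_top _ _)).1 h5
  rw [← measure_inter_add_sdiff S hI, ← measure_inter_add_sdiff (μ := gaussianReal b 1) S hI,
    add_right_comm]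
  exact add_le_add h3 h1

lemma gaussianReal_le_add (a b : ℝ) {S : Set ℝ} (hS : MeasurableSet S) :
    gaussianReal a 1 S ≤ gaussianReal b 1 S + ENNReal.ofReal |a - b| := by
  rcases le_total a b with h | h
  · rw [abs_sub_comm, abs_of_nonneg (sub_nonneg.2 h)]
    exact gaussianReal_le_add_of_le h hS
  · rw [abs_of_nonneg (sub_nonneg.2 h)]
    exact measure_le_add_symm (fun _ => gaussianReal_le_add_of_le h) hS

/-- A Gaussian with unit variance puts mass at least `1/5` on the interval `[2j, 2j + 2)` that
contains its mean. -/
lemma fifth_le_gaussianReal_bin (a : ℝ) :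
    ENNReal.ofReal (1 / 5) ≤ gaussianReal a 1 {x | ⌊x / 2⌋ = ⌊a / 2⌋} := by
  have hmass : ∀ c : ℝ, (∀ x ∈ Set.Ico c (c + 1), |x - a| ≤ 1) →
      ENNReal.ofReal (1 / 5) ≤ gaussianReal a 1 (Set.Ico c (c + 1)) := by
    intro c hc
    rw [gaussianReal_apply a one_ne_zero]
    calc ENNReal.ofReal (1 / 5) = ∫⁻ _ in Set.Ico c (c + 1), ENNReal.ofReal (1 / 5) := by simp
      _ ≤ _ := setLIntegral_mono' measurableSet_Ico fun x hx =>
          ENNReal.ofReal_le_ofReal (fifth_le_gaussianPDFReal (hc x hx))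
  have h1 := Int.floor_le (a / 2)
  have h2 := Int.lt_floor_add_one (a / 2)
  -- The bin has length 2, so it contains `[a, a + 1)` or `[a - 1, a)`, according to the half in
  -- which `a` lies.
  rcases le_total a (2 * ⌊a / 2⌋ + 1) with h | h
  · refine (hmass a fun x hx => ?_).trans (measure_mono fun x hx => ?_)
    · rw [abs_le]; constructor <;> linarith [hx.1, hx.2]
    · exact Int.floor_eq_iff.2 ⟨by linarith [hx.1], by linarith [hx.2]⟩
  · refine (hmass (a - 1) fun x hx => ?_).trans (measure_mono fun x hx => ?_)
    · rw [abs_le]; constructor <;> linarith [hx.1, hx.2]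
    · exact Int.floor_eq_iff.2 ⟨by linarith [hx.1], by linarith [hx.2]⟩

/-- `N(μ, I)` as a product measure. -/
lemma multivariateGaussian_one_eq_map_pi {d : ℕ} (μ : EuclideanSpace ℝ (Fin d)) :
    multivariateGaussian μ 1 =
      (Measure.pi fun i => gaussianReal (μ i) 1).map (WithLp.toLp 2) := by
  have h : Measure.pi (fun i => gaussianReal (μ i) 1) =
      (Measure.pi fun _ : Fin d => gaussianReal 0 1).map fun x i => x i + μ i := by
    have h1 : (fun i => gaussianReal (μ i) 1) =
        fun i => (gaussianReal 0 1).map (fun x => x + μ i) := by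
      funext i
      rw [gaussianReal_map_add_const, zero_add]
    rw [h1]
    exact (Measure.pi_map_pi (μ := fun _ : Fin d => gaussianReal 0 1)
      (f := fun i x => x + μ i) fun i => by fun_prop).symm
  rw [h, multivariateGaussian, ← map_pi_eq_stdGaussian, Measure.map_map (by fun_prop) (by fun_prop),
    Measure.map_map (by fun_prop) (by fun_prop)]
  congr 1
  funext x
  ext i
  simp [add_comm]

/-- The Gaussian `N(μ, I)` as a bundled probability measure. -/
noncomputable def gaussianPM {d : ℕ} (μ : EuclideanSpace ℝ (Fin d)) :
    ProbabilityMeasure (EuclideanSpace ℝ (Fin d)) :=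
  ⟨multivariateGaussian μ 1, inferInstance⟩

lemma tvDist_gaussianPM_le {d : ℕ} (μ ν : EuclideanSpace ℝ (Fin d)) :
    tvDist (gaussianPM μ) (gaussianPM ν) ≤ ∑ i, |μ i - ν i| := by
  have key : ∀ μ ν : EuclideanSpace ℝ (Fin d), ∀ S, MeasurableSet S →
      multivariateGaussian μ 1 S ≤
        multivariateGaussian ν 1 S + ENNReal.ofReal (∑ i, |μ i - ν i|) := by
    intro μ ν S hS
    have hm : Measurable (WithLp.toLp 2 : (Fin d → ℝ) → EuclideanSpace ℝ (Fin d)) := by fun_prop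
    rw [multivariateGaussian_one_eq_map_pi, multivariateGaussian_one_eq_map_pi,
      Measure.map_apply hm hS, Measure.map_apply hm hS,
      ENNReal.ofReal_sum_of_nonneg fun i _ => abs_nonneg _]
    exact pi_le_pi_add (fun i S hS => gaussianReal_le_add _ _ hS) (hm hS)
  refine tvDist_le (Finset.sum_nonneg fun i _ => abs_nonneg _) (key μ ν) fun S hS => ?_
  simp_rw [abs_sub_comm (μ _)]
  exact key ν μ S hS

lemma fifth_le_multivariateGaussian_bin {d : ℕ} (μ : EuclideanSpace ℝ (Fin d)) (i : Fin d) :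
    ENNReal.ofReal (1 / 5) ≤ multivariateGaussian μ 1 {x | ⌊x i / 2⌋ = ⌊μ i / 2⌋} := by
  have h := measurePreserving_eval_multivariateGaussian (μ := μ) (i := i)
    (Matrix.PosSemidef.one (n := Fin d) (R := ℝ))
  rw [Matrix.one_apply_eq, Real.toNNReal_one] at h
  have hS : MeasurableSet {x : ℝ | ⌊x / 2⌋ = ⌊μ i / 2⌋} :=
    (measurable_id.div_const (2 : ℝ)).floor (measurableSet_singleton _)
  have := h.measure_preimage hS.nullMeasurableSet
  exact (fifth_le_gaussianReal_bin (μ i)).trans this.ge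

end Gaussian

/-! ### Concentration of cell counts. -/

section Concentration

/-- Multiplicative Chernoff bound for the number of samples in a cell. -/
lemma pi_count_lt_le {X : Type*} [MeasurableSpace X] {g : Measure X} [IsProbabilityMeasure g]
    {h : X → ℤ} (hh : Measurable h) {j : ℤ} {q : ℝ}
    (hqg : ENNReal.ofReal q ≤ g {x | h x = j}) (n : ℕ) :
    Measure.pi (fun _ : Fin n => g)
        {D | ((Finset.univ.filter fun k => h (D k) = j).card : ℝ) < n * q / 4} ≤
      ENNReal.ofReal (Real.exp (-(n * q / 4))) := by
  have hA : MeasurableSet {x | h x = j} := hh (measurableSet_singleton j)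
  set A := {x | h x = j}
  have hqr : q ≤ g.real A := by
    rcases le_total q 0 with h0 | h0
    · exact h0.trans measureReal_nonneg
    · exact (ENNReal.ofReal_le_iff_le_toReal (measure_ne_top _ _)).1 hqg
  -- This is `exp (-1)` on `A` and 1 elsewhere, so the product over the samples is `exp (-count)`.
  set f : X → ℝ := fun x => 1 - (1 - Real.exp (-1)) * A.indicator 1 x
  have he : Real.exp (-1) ≤ 1 / 2 := Real.exp_neg_one_lt_d9.le.trans (by norm_num)
  have hint : ∫ x, f x ∂g = 1 - (1 - Real.exp (-1)) * g.real A := by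
    have hi : Integrable (A.indicator (1 : X → ℝ)) g :=
      (integrable_const (1 : ℝ)).indicator hA
    rw [integral_sub (integrable_const _) (hi.const_mul _), integral_const_mul,
      integral_indicator_one hA]
    simp
  have hfv : ∀ x, f x = if h x = j then Real.exp (-1) else 1 := by
    intro x
    by_cases hx : h x = j
    · simp [f, A, hx]
    · simp [f, A, hx]
  have hF : ∀ D : Fin n → X,
      ∏ k, f (D k) = Real.exp (-((Finset.univ.filter fun k => h (D k) = j).card : ℝ)) := by
    intro D
    simp_rw [hfv]
    rw [Finset.prod_ite]
    simp [← Real.exp_nat_mul]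
  have hf0 : ∀ x, 0 ≤ f x := fun x => by rw [hfv]; split_ifs <;> positivity
  have hfm : Measurable f := by
    exact measurable_const.sub (measurable_const.mul (measurable_one.indicator hA))
  have hf1 : ∀ x, f x ≤ 1 := fun x => by rw [hfv]; split_ifs <;> linarith
  have hFint : Integrable (fun D : Fin n → X => ∏ k, f (D k)) (Measure.pi fun _ => g) := by
    refine Integrable.of_bound (C := 1) (Finset.measurable_prod _ fun k _ =>
      hfm.comp (measurable_pi_apply k)).aestronglyMeasurable (ae_of_all _ fun D => ?_)
    rw [Real.norm_of_nonneg (Finset.prod_nonneg fun k _ => hf0 _)]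
    exact Finset.prod_le_one (fun k _ => hf0 _) fun k _ => hf1 _
  have markov := mul_meas_ge_le_integral_of_nonneg
    (ae_of_all _ fun D => Finset.prod_nonneg fun k _ => hf0 (D k)) hFint
    (Real.exp (-(n * q / 4)))
  rw [integral_fintype_prod_eq_pow, hint, Fintype.card_fin] at markov
  have hgA : g.real A ≤ 1 := measureReal_le_one
  -- The expectation is at most `exp (-nq/2)`; Markov at level `exp (-nq/4)` leaves `exp (-nq/4)`.
  have hbound : (1 - (1 - Real.exp (-1)) * g.real A) ^ n ≤
      Real.exp (-(n * q / 4)) * Real.exp (-(n * q / 4)) := by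
    have h1 : 1 - (1 - Real.exp (-1)) * g.real A ≤ Real.exp (-(q / 2)) := by
      have := Real.add_one_le_exp (-(q / 2))
      have h0 : 0 ≤ g.real A := measureReal_nonneg
      nlinarith
    calc _ ≤ Real.exp (-(q / 2)) ^ n := by
          refine pow_le_pow_left₀ ?_ h1 n
          nlinarith [Real.exp_pos (-1), measureReal_nonneg (μ := g) (s := A)]
      _ = _ := by rw [← Real.exp_nat_mul, ← Real.exp_add]; congr 1; ring
  have h2 := le_of_mul_le_mul_left (markov.trans hbound) (Real.exp_pos _)
  refine (measure_mono fun D hD => ?_).trans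
    ((ENNReal.le_ofReal_iff_toReal_le (measure_ne_top _ _) (Real.exp_pos _).le).2 h2)
  simp only [Set.mem_ofPred_eq, hF] at hD ⊢
  exact Real.exp_le_exp.2 (neg_le_neg hD.le)

end Concentration

/-! ### From selected cells to a list of Gaussians. -/

section Decoding

variable {d : ℕ}

/-- Candidate values of the `i`-th coordinate of the mean: grids of width `α / d` in the selected
intervals `[2j, 2j + 2)`. -/
noncomputable def candidates (α : ℝ) (s : Finset (Fin d × ℤ)) (i : Fin d) : Finset ℝ :=
  ((s.filter fun b => b.1 = i) ×ˢ Finset.range (⌊2 * d / α⌋₊ + 1)).image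
    fun a => 2 * (a.1.2 : ℝ) + a.2 * (α / d)

open Classical in
/-- The list of Gaussians whose mean has only candidate coordinates. -/
noncomputable def decode (α : ℝ) (s : Finset (Fin d × ℤ)) :
    DistList (EuclideanSpace ℝ (Fin d)) where
  elems := (Fintype.piFinset (candidates α s)).image fun v => gaussianPM (WithLp.toLp 2 v)

lemma card_candidates_le (hd : 1 ≤ d) {α : ℝ} (hα : α ∈ Set.Ioo (0 : ℝ) 1)
    {s : Finset (Fin d × ℤ)} {i : Fin d} {M : ℝ}
    (h : ((s.filter fun b => b.1 = i).card : ℝ) ≤ M) :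
    ((candidates α s i).card : ℝ) ≤ M * (3 * d / α) := by
  have hd' : (1 : ℝ) ≤ d := by exact_mod_cast hd
  have hα0 := hα.1
  have h1 : (candidates α s i).card ≤
      (s.filter fun b => b.1 = i).card * (⌊2 * d / α⌋₊ + 1) := by
    refine Finset.card_image_le.trans ?_
    rw [Finset.card_product, Finset.card_range]
  have h2 : ((candidates α s i).card : ℝ) ≤
      (s.filter fun b => b.1 = i).card * (⌊2 * d / α⌋₊ + 1 : ℝ) := by exact_mod_cast h1
  refine h2.trans (mul_le_mul h ?_ (by positivity) ((Nat.cast_nonneg _).trans h))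
  have h3 : (⌊2 * d / α⌋₊ : ℝ) ≤ 2 * d / α := Nat.floor_le (by positivity)
  have h4 : 1 ≤ d / α := by rw [one_le_div hα0]; linarith [hα.2]
  calc _ ≤ 2 * d / α + d / α := add_le_add h3 h4
    _ = 3 * d / α := by ring

open Classical in
lemma card_decode_le (hd : 1 ≤ d) {α : ℝ} (hα : α ∈ Set.Ioo (0 : ℝ) 1)
    {s : Finset (Fin d × ℤ)} {M : ℝ}
    (h : ∀ i, ((s.filter fun b => b.1 = i).card : ℝ) ≤ M) :
    ((decode α s).elems.card : ℝ) ≤ (M * (3 * d / α)) ^ d := by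
  have h1 : (decode α s).elems.card ≤ ∏ i, (candidates α s i).card :=
    Finset.card_image_le.trans (Fintype.card_piFinset _).le
  calc ((decode α s).elems.card : ℝ) ≤ ∏ i, ((candidates α s i).card : ℝ) := by exact_mod_cast h1
    _ ≤ ∏ _i : Fin d, M * (3 * d / α) :=
        Finset.prod_le_prod (fun _ _ => Nat.cast_nonneg _) fun i _ => card_candidates_le hd hα (h i)
    _ = _ := by simp

/-- Round `x` down to the grid that starts at the left end of its bin. -/
lemma exists_mem_candidates_near (hd : 1 ≤ d) {α : ℝ} (hα : α ∈ Set.Ioo (0 : ℝ) 1)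
    {s : Finset (Fin d × ℤ)} {i : Fin d} {x : ℝ} (h : (i, ⌊x / 2⌋) ∈ s) :
    ∃ y ∈ candidates α s i, |x - y| ≤ α / d := by
  have hd' : (0 : ℝ) < d := by exact_mod_cast hd
  have hα0 := hα.1
  have hw : 0 < α / d := by positivity
  have h1 := Int.floor_le (x / 2)
  have h2 := Int.lt_floor_add_one (x / 2)
  set r := x - 2 * ⌊x / 2⌋ with hr
  have hr0 : 0 ≤ r := by linarith
  have ht1 := Nat.floor_le (a := r / (α / d)) (by positivity)
  have ht2 := Nat.lt_floor_add_one (r / (α / d))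
  rw [le_div_iff₀ hw] at ht1
  rw [div_lt_iff₀ hw] at ht2
  refine ⟨2 * ⌊x / 2⌋ + ⌊r / (α / d)⌋₊ * (α / d), Finset.mem_image.2
    ⟨((i, ⌊x / 2⌋), ⌊r / (α / d)⌋₊), Finset.mem_product.2 ⟨by simp [h], ?_⟩, rfl⟩, ?_⟩
  · rw [Finset.mem_range, Nat.lt_succ_iff]
    refine Nat.floor_le_floor ?_
    rw [div_div_eq_mul_div, div_le_div_iff_of_pos_right hα0]
    exact mul_le_mul_of_nonneg_right (by linarith) hd'.le
  · rw [abs_le]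
    constructor <;> linarith

open Classical in
lemma tvDistToSet_decode_le (hd : 1 ≤ d) {α : ℝ} (hα : α ∈ Set.Ioo (0 : ℝ) 1)
    {s : Finset (Fin d × ℤ)} {μ : EuclideanSpace ℝ (Fin d)} (h : ∀ i, (i, ⌊μ i / 2⌋) ∈ s) :
    tvDistToSet (gaussianPM μ) ((decode α s).elems : Set (ProbabilityMeasure _)) ≤
      ENNReal.ofReal α := by
  have hd' : (0 : ℝ) < d := by exact_mod_cast hd
  choose v hv hd using fun i => exists_mem_candidates_near hd hα (h i)
  have hmem : gaussianPM (WithLp.toLp 2 v) ∈ (decode α s).elems :=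
    Finset.mem_image.2 ⟨v, Fintype.mem_piFinset.2 hv, rfl⟩
  refine (iInf₂_le _ (Finset.mem_coe.2 hmem)).trans (ENNReal.ofReal_le_ofReal ?_)
  calc _ ≤ ∑ i, |μ i - v i| := tvDist_gaussianPM_le _ _
    _ ≤ ∑ _i : Fin d, α / d := Finset.sum_le_sum fun i _ => hd i
    _ = α := by
      rw [Finset.sum_const, Finset.card_univ, Fintype.card_fin, nsmul_eq_mul]
      field_simp

end Decoding

/-! ### The learner: privacy, list size and success on good data. -/

section Learner

variable {d : ℕ} {ε δ : ℝ}

/-- Index `j` of the interval `[2j, 2j + 2)` that contains `x i`, for every coordinate `i`. -/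
noncomputable def binOf (x : EuclideanSpace ℝ (Fin d)) (i : Fin d) : ℤ := ⌊x i / 2⌋

lemma measurable_binOf_apply (i : Fin d) :
    Measurable fun x : EuclideanSpace ℝ (Fin d) => binOf x i := by
  unfold binOf
  exact Measurable.floor (by fun_prop)

lemma measurable_binOf : Measurable (binOf : EuclideanSpace ℝ (Fin d) → Fin d → ℤ) :=
  measurable_pi_lambda _ measurable_binOf_apply

lemma measurable_binOf_data {n : ℕ} :
    Measurable fun (D : Fin n → EuclideanSpace ℝ (Fin d)) k => binOf (D k) :=
  measurable_pi_lambda _ fun k => measurable_binOf.comp (measurable_pi_apply k)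

/-- The learner: bin each coordinate, select heavy cells privately, and output all Gaussians whose
means have coordinates on a grid in the selected cells. -/
noncomputable def histogramLearner (hd : 1 ≤ d) (ε : ℝ) (hδ : δ ∈ Set.Ioo (0 : ℝ) 1) (α γ : ℝ) :
    RandomizedAlgorithm (EuclideanSpace ℝ (Fin d)) (DistList (EuclideanSpace ℝ (Fin d))) where
  -- The output depends on the data only through the bins, which take countably many values;
  -- measurability of the law therefore reduces to that of the binning.
  law n := (Kernel.ofFunOfCountable fun Z : Fin n → Fin d → ℤ =>
    subsetLaw (cells Z) (fun b => selectProb d ε δ γ n (cellCount Z b)) (decode α)).comap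
      (fun D k => binOf (D k)) measurable_binOf_data
  isMarkov n := ⟨fun _ => isProbabilityMeasure_subsetLaw
    (fun _ => selectProb_mem_Icc hd hδ n _) _⟩

lemma histogramLearner_law (hd : 1 ≤ d) (hδ : δ ∈ Set.Ioo (0 : ℝ) 1) (α γ : ℝ) (n : ℕ)
    (D : Fin n → EuclideanSpace ℝ (Fin d)) :
    (histogramLearner hd ε hδ α γ).law n D = subsetLaw (cells fun k => binOf (D k))
      (fun b => selectProb d ε δ γ n (cellCount (fun k => binOf (D k)) b)) (decode α) := rfl

lemma isDP_histogramLearner (hd : 1 ≤ d) (hε : ε ∈ Set.Ioo (0 : ℝ) 1)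
    (hδ : δ ∈ Set.Ioo (0 : ℝ) 1) {α γ : ℝ} (hγ : γ ∈ Set.Ioo (0 : ℝ) 1) :
    IsDP ε δ (histogramLearner hd ε hδ α γ) := by
  intro n hn D D' hDD S hS
  obtain ⟨k₀, hk⟩ : ∃ k₀, ∀ k, k ≠ k₀ → D k = D' k := by
    -- If the datasets coincide, any index can play the changed point, and `1 ≤ n` supplies one.
    obtain h | ⟨k₀, h⟩ := Set.ncard_le_one_iff_subsingleton.1 hDD |>.eq_empty_or_singleton
    · exact ⟨⟨0, hn⟩, fun k _ => by
        by_contra hne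
        exact (h ▸ hne : k ∈ (∅ : Set (Fin n)))⟩
    · refine ⟨k₀, fun k hk => ?_⟩
      by_contra hne
      have : k ∈ ({k₀} : Set (Fin n)) := h ▸ hne
      exact hk this
  have hp : ∀ Z : Fin n → Fin d → ℤ, ∀ b,
      selectProb d ε δ γ n (cellCount Z b) ∈ Set.Icc (0 : ℝ) 1 :=
    fun Z b => selectProb_mem_Icc hd hδ n _
  rw [histogramLearner_law, histogramLearner_law, subsetLaw_apply (hp _) _ hS,
    subsetLaw_apply (hp _) _ hS, ← ENNReal.ofReal_mul (Real.exp_pos _).le,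
    ← ENNReal.ofReal_add _ hδ.1.le]
  · refine ENNReal.ofReal_le_ofReal (subsetExp_cells_le hd hε hδ.1.le
      (fun k => selectProb_mem_Icc hd hδ n k) ?_ (bernoulliClose_selectProb hd hε hδ n) (k₀ := k₀)
      (fun k h => by rw [hk k h]) (indicator_one_mem_Icc _))
    refine selectProb_eq_zero hd hε hδ hγ ?_
    have : 0 ≤ 1 - γ := sub_nonneg.2 hγ.2.le
    rw [Nat.cast_zero, lowCount]
    positivity
  · exact mul_nonneg (Real.exp_pos _).le (subsetExp_mem_Icc (hp _) (indicator_one_mem_Icc _)).1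

/-- The cells of one coordinate are disjoint, so their counts sum to at most `n`, while each exceeds
`(1 - γ)n/80`. -/
lemma card_filter_le_of_lowCount_lt {n : ℕ} (hn : 1 ≤ n) {γ : ℝ} (hγ : γ ∈ Set.Ioo (0 : ℝ) 1)
    {Z : Fin n → Fin d → ℤ} {s : Finset (Fin d × ℤ)}
    (hs : ∀ b ∈ s, lowCount γ n < cellCount Z b) (i : Fin d) :
    ((s.filter fun b => b.1 = i).card : ℝ) ≤ 80 / (1 - γ) := by
  have hγ1 : 0 < 1 - γ := sub_pos.2 hγ.2
  have hn' : (0 : ℝ) < n := by exact_mod_cast hn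
  have h1 : (∑ b ∈ s.filter (fun b => b.1 = i), (cellCount Z b : ℝ)) ≤ n := by
    exact_mod_cast sum_cellCount_le Z i _ fun b hb => (Finset.mem_filter.1 hb).2
  have h2 := Finset.card_nsmul_le_sum (s.filter fun b => b.1 = i) (fun b => (cellCount Z b : ℝ))
    (lowCount γ n) fun b hb => (hs b (Finset.mem_filter.1 hb).1).le
  have h3 := h2.trans h1
  rw [nsmul_eq_mul, lowCount] at h3
  rw [le_div_iff₀ hγ1]
  refine le_of_mul_le_mul_right ?_ hn'
  linarith

lemma ae_card_histogramLearner_le (hd : 1 ≤ d) (hε : ε ∈ Set.Ioo (0 : ℝ) 1)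
    (hδ : δ ∈ Set.Ioo (0 : ℝ) 1) {α γ : ℝ} (hα : α ∈ Set.Ioo (0 : ℝ) 1)
    (hγ : γ ∈ Set.Ioo (0 : ℝ) 1) {n : ℕ} (hn : 1 ≤ n) (D : Fin n → EuclideanSpace ℝ (Fin d)) :
    ∀ᵐ l ∂((histogramLearner hd ε hδ α γ).law n D),
      (l.elems.card : ℝ) ≤ (80 / (1 - γ) * (3 * d / α)) ^ d := by
  have := (histogramLearner hd ε hδ α γ).isMarkov n
  refine (prob_compl_eq_zero_iff MeasurableSpace.measurableSet_top).2 ?_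
  rw [histogramLearner_law]
  refine subsetLaw_eq_one (fun _ => selectProb_mem_Icc hd hδ n _) _
    MeasurableSpace.measurableSet_top fun s _ hs _ => ?_
  refine card_decode_le hd hα (card_filter_le_of_lowCount_lt
    (Z := fun k => binOf (D k)) hn hγ fun b hb => ?_)
  by_contra hlt
  exact hs b hb (selectProb_eq_zero hd hε hδ hγ (not_lt.1 hlt))

/-- When the cells of the mean are heavy, the output contains a good approximation. -/
lemma histogramLearner_law_good (hd : 1 ≤ d) (hε : ε ∈ Set.Ioo (0 : ℝ) 1)
    (hδ : δ ∈ Set.Ioo (0 : ℝ) 1) {α γ : ℝ} (hα : α ∈ Set.Ioo (0 : ℝ) 1)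
    (hγ : γ ∈ Set.Ioo (0 : ℝ) 1) {n : ℕ} (hn : 1 ≤ n) (hn1 : n ≠ 1)
    (μ : EuclideanSpace ℝ (Fin d)) (hslack : 2 * countSlack d ε δ ≤ 3 * (1 - γ) * n / 80)
    {D : Fin n → EuclideanSpace ℝ (Fin d)}
    (hD : ∀ i, n * ((1 - γ) / 5) / 4 ≤
      ((Finset.univ.filter fun k => binOf (D k) i = ⌊μ i / 2⌋).card : ℝ)) :
    (histogramLearner hd ε hδ α γ).law n D
      {l | tvDistToSet (gaussianPM μ) (l.elems : Set (ProbabilityMeasure _)) ≤ ENNReal.ofReal α}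
      = 1 := by
  have hγ1 : 0 < 1 - γ := sub_pos.2 hγ.2
  have hn' : (0 : ℝ) < n := by exact_mod_cast hn
  rw [histogramLearner_law]
  refine subsetLaw_eq_one (fun _ => selectProb_mem_Icc hd hδ n _) _
    MeasurableSpace.measurableSet_top fun s _ _ hs => ?_
  refine tvDistToSet_decode_le hd hα fun i => ?_
  have hcount : n * ((1 - γ) / 5) / 4 ≤
      (cellCount (fun k => binOf (D k)) (i, ⌊μ i / 2⌋) : ℝ) := hD i
  refine hs _ ?_ (selectProb_eq_one hd hε hδ hn1 ?_)
  · by_contra hne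
    rw [cellCount_eq_zero hne, Nat.cast_zero] at hcount
    have : 0 < n * ((1 - γ) / 5) / 4 := by positivity
    linarith
  -- `1/80 + 3/80 = 1/20`: the window ends before the guaranteed count of the true cell.
  · rw [lowCount]
    linarith

/-- With a single sample that falls into the cell of a one-dimensional mean, the output contains a
good approximation with probability at least `δ / 6`. -/
lemma histogramLearner_law_one_good (hδ : δ ∈ Set.Ioo (0 : ℝ) 1) {α γ : ℝ}
    (hα : α ∈ Set.Ioo (0 : ℝ) 1) (μ : EuclideanSpace ℝ (Fin 1))
    {D : Fin 1 → EuclideanSpace ℝ (Fin 1)} (hD : binOf (D 0) 0 = ⌊μ 0 / 2⌋) :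
    ENNReal.ofReal (δ / 6) ≤ (histogramLearner le_rfl ε hδ α γ).law 1 D
      {l | tvDistToSet (gaussianPM μ) (l.elems : Set (ProbabilityMeasure _)) ≤
        ENNReal.ofReal α} := by
  rw [histogramLearner_law]
  have hc : cellCount (fun k => binOf (D k)) (0, ⌊μ 0 / 2⌋) ≠ 0 := by
    simp [cellCount, hD, Finset.filter_true_of_mem]
  have hb : (0, ⌊μ 0 / 2⌋) ∈ cells fun k => binOf (D k) := by
    by_contra hne
    exact hc (cellCount_eq_zero hne)
  refine le_trans (le_of_eq ?_) (le_subsetLaw (fun _ => selectProb_mem_Icc le_rfl hδ 1 _) _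
    MeasurableSpace.measurableSet_top hb fun s hs => tvDistToSet_decode_le le_rfl hα fun i => ?_)
  · simp [selectProb, hc]
  · rwa [Subsingleton.elim i 0]

/-- The contamination `h` can only add mass to the cell. -/
lemma le_measure_bin_of_mem_corrupted {γ : ℝ} (hγ : γ ∈ Set.Ioo (0 : ℝ) 1)
    {μ : EuclideanSpace ℝ (Fin d)} {g : ProbabilityMeasure (EuclideanSpace ℝ (Fin d))}
    (hg : g ∈ corrupted γ (gaussianPM μ)) (i : Fin d) :
    ENNReal.ofReal ((1 - γ) / 5) ≤
      (g : Measure (EuclideanSpace ℝ (Fin d))) {x | binOf x i = ⌊μ i / 2⌋} := by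
  obtain ⟨h, hg⟩ := hg
  rw [hg, Measure.add_apply, Measure.smul_apply, div_eq_mul_one_div,
    ENNReal.ofReal_mul (sub_nonneg.2 hγ.2.le)]
  exact (mul_le_mul_right (fifth_le_multivariateGaussian_bin μ i) _).trans le_self_add

end Learner

/-! ### Consequences of the sample size bound. -/

section SampleSize

lemma mul_log_le_of_sampleSize_le {d n : ℕ} {ε β δ γ : ℝ} (hε : ε ∈ Set.Ioo (0 : ℝ) 1)
    (hγ : γ ∈ Set.Ioo (0 : ℝ) 1)
    (hm : 1000 * (d * Real.log (d / (β * δ)) / ((1 - γ) * ε)) ≤ n) :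
    1000 * (d * Real.log (d / (β * δ))) ≤ n * ((1 - γ) * ε) := by
  have h : 0 < (1 - γ) * ε := mul_pos (sub_pos.2 hγ.2) hε.1
  rwa [← mul_div_assoc, div_le_iff₀ h] at hm

lemma countSlack_le {d n : ℕ} (hd : 1 ≤ d) {ε β δ γ : ℝ} (hε : ε ∈ Set.Ioo (0 : ℝ) 1)
    (hβ : β ∈ Set.Ioo (0 : ℝ) 1) (hδ : δ ∈ Set.Ioo (0 : ℝ) 1) (hX : 2 ≤ d / (β * δ))
    (hm : 1000 * (d * Real.log (d / (β * δ))) ≤ n * ((1 - γ) * ε)) :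
    2 * countSlack d ε δ ≤ 3 * (1 - γ) * n / 80 := by
  have hd' : (1 : ℝ) ≤ d := by exact_mod_cast hd
  have hε0 := hε.1
  have hβ0 := hβ.1
  have hδ0 := hδ.1
  -- With `X = d/(βδ) ≥ 2`, both `24 ≤ 2^5 ≤ X^5` and `d/δ ≤ X` hold.
  have hlog : Real.log (24 * d / δ) ≤ 6 * Real.log (d / (β * δ)) := by
    have h1 : d / δ ≤ d / (β * δ) :=
      div_le_div_of_nonneg_left (by linarith) (by positivity)
        (mul_le_of_le_one_left hδ0.le hβ.2.le)
    set X := d / (β * δ)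
    have h2 : (2 : ℝ) ^ 5 ≤ X ^ 5 := pow_le_pow_left₀ (by norm_num) hX 5
    rw [show (6 : ℝ) * Real.log X = ((6 : ℕ) : ℝ) * Real.log X by norm_num, ← Real.log_pow]
    refine Real.log_le_log (by positivity) ?_
    calc 24 * (d : ℝ) / δ = 24 * (d / δ) := by ring
      _ ≤ X ^ 5 * X := mul_le_mul (by linarith) h1 (by positivity) (by positivity)
      _ = X ^ 6 := by ring
  have h3 : ε * countSlack d ε δ = 2 * d * Real.log (24 * d / δ) := by
    rw [countSlack]; field_simp
  have hlog0 : 0 ≤ Real.log (d / (β * δ)) := Real.log_nonneg (by linarith)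
  have h4 := mul_le_mul_of_nonneg_left hlog (by linarith : (0 : ℝ) ≤ 2 * d)
  refine le_of_mul_le_mul_left ?_ hε0
  nlinarith [mul_nonneg (by linarith : (0 : ℝ) ≤ d) hlog0]

lemma mul_exp_neg_le {d n : ℕ} (hd : 1 ≤ d) {ε β δ γ : ℝ} (hε : ε ∈ Set.Ioo (0 : ℝ) 1)
    (hβ : β ∈ Set.Ioo (0 : ℝ) 1) (hδ : δ ∈ Set.Ioo (0 : ℝ) 1) (hγ : γ ∈ Set.Ioo (0 : ℝ) 1)
    (hX : 2 ≤ d / (β * δ)) (hm : 1000 * (d * Real.log (d / (β * δ))) ≤ n * ((1 - γ) * ε)) :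
    d * Real.exp (-(n * ((1 - γ) / 5) / 4)) ≤ β := by
  have hd' : (1 : ℝ) ≤ d := by exact_mod_cast hd
  have hβ0 := hβ.1
  have hδ0 := hδ.1
  have hγ1 : 0 < 1 - γ := sub_pos.2 hγ.2
  have hlog0 : 0 ≤ Real.log (d / (β * δ)) := Real.log_nonneg (by linarith)
  have h1 : Real.log (d / β) ≤ Real.log (d / (β * δ)) := by
    refine Real.log_le_log (by positivity) (div_le_div_of_nonneg_left (by linarith)
      (by positivity) (mul_le_of_le_one_right hβ0.le hδ.2.le))
  have h2 : (n : ℝ) * ((1 - γ) * ε) ≤ n * (1 - γ) := by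
    rw [← mul_assoc]
    exact mul_le_of_le_one_right (by positivity) hε.2.le
  have h3 : Real.log (d / (β * δ)) ≤ d * Real.log (d / (β * δ)) :=
    le_mul_of_one_le_left hlog0 hd'
  have h4 : Real.exp (-(n * ((1 - γ) / 5) / 4)) ≤ β / d := by
    calc _ ≤ Real.exp (-Real.log (d / β)) := Real.exp_le_exp.2 (by linarith)
      _ = β / d := by rw [Real.exp_neg, Real.exp_log (by positivity), inv_div]
  calc d * Real.exp (-(n * ((1 - γ) / 5) / 4)) ≤ d * (β / d) :=
        mul_le_mul_of_nonneg_left h4 (by linarith)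
    _ = β := by field_simp

lemma two_le_div {d : ℕ} {β δ : ℝ} (hβ : β ∈ Set.Ioo (0 : ℝ) 1) (hδ : δ ∈ Set.Ioo (0 : ℝ) 1)
    (h : 2 * δ ≤ d) : 2 ≤ d / (β * δ) := by
  rw [le_div_iff₀ (mul_pos hβ.1 hδ.1)]
  nlinarith [hβ.2, hδ.1]

/-- For `d ≥ 2` the logarithm is at least `log 2`, and one sample is far too few. -/
lemma eq_one_of_sampleSize_le_one {d : ℕ} (hd : 1 ≤ d) {ε β δ γ : ℝ} (hε : ε ∈ Set.Ioo (0 : ℝ) 1)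
    (hβ : β ∈ Set.Ioo (0 : ℝ) 1) (hδ : δ ∈ Set.Ioo (0 : ℝ) 1) (hγ : γ ∈ Set.Ioo (0 : ℝ) 1)
    (hm : 1000 * (d * Real.log (d / (β * δ))) ≤ (1 - γ) * ε) : d = 1 := by
  by_contra hne
  have hd2 : (2 : ℝ) ≤ d := by exact_mod_cast (by omega : 2 ≤ d)
  have h1 : Real.log 2 ≤ Real.log (d / (β * δ)) :=
    Real.log_le_log (by norm_num) (two_le_div hβ hδ (by linarith [hδ.2]))
  have h2 : (1 - γ) * ε ≤ 1 :=
    mul_le_one₀ (by linarith [hγ.1]) hε.1.le hε.2.le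
  nlinarith [Real.log_two_gt_d9]

/-- From `1 - βδ ≤ log (1/(βδ)) ≤ (1 - γ)/1000`, the required success probability `1 - β` is tiny
and `δ` is almost 1. The right side is the chance that the sample hits the true cell and that the
cell is selected. -/
lemma one_sub_le_of_sampleSize_le_one {ε β δ γ : ℝ} (hε : ε ∈ Set.Ioo (0 : ℝ) 1)
    (hβ : β ∈ Set.Ioo (0 : ℝ) 1) (hδ : δ ∈ Set.Ioo (0 : ℝ) 1) (hγ : γ ∈ Set.Ioo (0 : ℝ) 1)
    (hm : 1000 * Real.log (1 / (β * δ)) ≤ (1 - γ) * ε) : 1 - β ≤ δ / 6 * ((1 - γ) / 5) := by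
  have hβδ : 0 < β * δ := mul_pos hβ.1 hδ.1
  have h1 : Real.log (β * δ) ≤ β * δ - 1 := Real.log_le_sub_one_of_pos hβδ
  rw [one_div, Real.log_inv] at hm
  have hγ1 : 0 < 1 - γ := sub_pos.2 hγ.2
  have h2 : (1 - γ) * ε ≤ 1 - γ := mul_le_of_le_one_right hγ1.le hε.2.le
  have h3 : β * δ ≤ β := mul_le_of_le_one_right hβ.1.le hδ.2.le
  have h4 : β * δ ≤ δ := mul_le_of_le_one_left hδ.1.le hβ.2.le
  nlinarith [hγ.1]

end SampleSize

/-! ### Accuracy and the final assembly. -/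

section Accuracy

lemma mul_le_bind_apply {X Y : Type*} [MeasurableSpace X] [MeasurableSpace Y] {m : Measure X}
    (κ : Kernel X Y) {S : Set Y} (hS : MeasurableSet S) {G : Set X} (hG : MeasurableSet G)
    {c : ℝ≥0∞} (h : ∀ x ∈ G, c ≤ κ x S) : c * m G ≤ m.bind κ S := by
  rw [Measure.bind_apply hS κ.aemeasurable, ← setLIntegral_const]
  exact (setLIntegral_mono' hG h).trans (setLIntegral_le_lintegral _ _)

variable {d : ℕ} {ε δ : ℝ}

lemma histogramLearner_accurate (hd : 1 ≤ d) (hε : ε ∈ Set.Ioo (0 : ℝ) 1)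
    (hδ : δ ∈ Set.Ioo (0 : ℝ) 1) {α β γ : ℝ} (hα : α ∈ Set.Ioo (0 : ℝ) 1)
    (hβ : β ∈ Set.Ioo (0 : ℝ) 1) (hγ : γ ∈ Set.Ioo (0 : ℝ) 1) {n : ℕ} (hn : 1 ≤ n)
    (hδn : δ < 1 / (n : ℝ)) (hm : 1000 * (d * Real.log (d / (β * δ)) / ((1 - γ) * ε)) ≤ n)
    (μ : EuclideanSpace ℝ (Fin d)) {g : ProbabilityMeasure (EuclideanSpace ℝ (Fin d))}
    (hg : g ∈ corrupted γ (gaussianPM μ)) :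
    ENNReal.ofReal (1 - β) ≤
      (Measure.pi (fun _ : Fin n => (g : Measure (EuclideanSpace ℝ (Fin d))))).bind
        ((histogramLearner hd ε hδ α γ).law n)
        {l | tvDistToSet (gaussianPM μ) (l.elems : Set (ProbabilityMeasure _)) ≤
          ENNReal.ofReal α} := by
  replace hm := mul_log_le_of_sampleSize_le hε hγ hm
  have hmass := le_measure_bin_of_mem_corrupted hγ hg
  by_cases hn1 : n = 1
  · subst hn1
    rw [Nat.cast_one, one_mul] at hm
    obtain rfl := eq_one_of_sampleSize_le_one hd hε hβ hδ hγ hm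
    rw [Nat.cast_one, one_mul] at hm
    have hA : MeasurableSet {x : EuclideanSpace ℝ (Fin 1) | binOf x 0 = ⌊μ 0 / 2⌋} :=
      measurable_binOf_apply 0 (measurableSet_singleton _)
    have hG := (measurePreserving_eval (fun _ : Fin 1 =>
      (g : Measure (EuclideanSpace ℝ (Fin 1)))) 0).measure_preimage hA.nullMeasurableSet
    have hgood : ∀ D ∈ Function.eval 0 ⁻¹' {x : EuclideanSpace ℝ (Fin 1) | binOf x 0 = ⌊μ 0 / 2⌋},
        ENNReal.ofReal (δ / 6) ≤ (histogramLearner hd ε hδ α γ).law 1 D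
          {l | tvDistToSet (gaussianPM μ) (l.elems : Set (ProbabilityMeasure _)) ≤
            ENNReal.ofReal α} := fun D hD => histogramLearner_law_one_good hδ hα μ hD
    refine le_trans ?_ (mul_le_bind_apply _ MeasurableSpace.measurableSet_top
      (measurable_pi_apply 0 hA) hgood)
    rw [hG]
    refine le_trans ?_ (mul_le_mul_right (hmass 0) _)
    rw [← ENNReal.ofReal_mul (div_nonneg hδ.1.le (by norm_num))]
    exact ENNReal.ofReal_le_ofReal (one_sub_le_of_sampleSize_le_one hε hβ hδ hγ hm)
  · have hn2 : (2 : ℝ) ≤ n := by exact_mod_cast (by omega : 2 ≤ n)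
    have hd' : (1 : ℝ) ≤ d := by exact_mod_cast hd
    -- Here `δ < 1/n` with `n ≥ 2` gives `2δ ≤ 1 ≤ d`.
    have hX : 2 ≤ d / (β * δ) := by
      refine two_le_div hβ hδ ?_
      rw [lt_div_iff₀ (by linarith)] at hδn
      nlinarith [hδ.1]
    let bad : Fin d → Set (Fin n → EuclideanSpace ℝ (Fin d)) := fun i =>
      {D | ((Finset.univ.filter fun k => binOf (D k) i = ⌊μ i / 2⌋).card : ℝ) <
        n * ((1 - γ) / 5) / 4}
    have hbad : ∀ i, MeasurableSet (bad i) := by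
      intro i
      have : Measurable fun D : Fin n → EuclideanSpace ℝ (Fin d) =>
          ((Finset.univ.filter fun k => binOf (D k) i = ⌊μ i / 2⌋).card : ℝ) :=
        (measurable_of_countable fun Z : Fin n → Fin d → ℤ =>
          ((Finset.univ.filter fun k => Z k i = ⌊μ i / 2⌋).card : ℝ)).comp measurable_binOf_data
      exact measurableSet_lt this measurable_const
    have hU : MeasurableSet (⋃ i, bad i) := MeasurableSet.iUnion hbad
    have hprob : Measure.pi (fun _ : Fin n => (g : Measure (EuclideanSpace ℝ (Fin d))))
        (⋃ i, bad i) ≤ ENNReal.ofReal β := by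
      calc _ ≤ ∑ i, Measure.pi (fun _ : Fin n => (g : Measure (EuclideanSpace ℝ (Fin d))))
            (bad i) := measure_iUnion_fintype_le _ _
        _ ≤ ∑ _i : Fin d, ENNReal.ofReal (Real.exp (-(n * ((1 - γ) / 5) / 4))) :=
            Finset.sum_le_sum fun i _ => pi_count_lt_le (measurable_binOf_apply i) (hmass i) n
        _ = ENNReal.ofReal (d * Real.exp (-(n * ((1 - γ) / 5) / 4))) := by
            rw [ENNReal.ofReal_mul (by linarith)]; simp
        _ ≤ _ := ENNReal.ofReal_le_ofReal (mul_exp_neg_le hd hε hβ hδ hγ hX hm)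
    -- Outside the bad events the true cells are selected with certainty, so only the sampling can
    -- fail.
    refine le_trans ?_ (mul_le_bind_apply (c := 1) _ MeasurableSpace.measurableSet_top hU.compl
      fun D hD => (histogramLearner_law_good hd hε hδ hα hγ hn hn1 μ
        (countSlack_le hd hε hβ hδ hX hm) fun i => ?_).ge)
    · rw [one_mul, prob_compl_eq_one_sub hU, ENNReal.ofReal_sub _ hβ.1.le, ENNReal.ofReal_one]
      exact tsub_le_tsub_left hprob 1
    · exact not_lt.1 fun hlt => hD (Set.mem_iUnion.2 ⟨i, hlt⟩)

/-- The learner is private and list-decodes `N(μ, I)`. -/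
lemma isDPListDecodableLearner_histogramLearner (hd : 1 ≤ d) (hε : ε ∈ Set.Ioo (0 : ℝ) 1)
    (hδ : δ ∈ Set.Ioo (0 : ℝ) 1) :
    IsDPListDecodableLearner ε δ (fun α _ γ => histogramLearner hd ε hδ α γ)
      (identityGaussians d) (fun α _ γ => (1000 * (d / ((1 - γ) * α))) ^ d)
      (fun _ β γ => 1000 * (d * Real.log (d / (β * δ)) / ((1 - γ) * ε)))
      {n : ℕ | 1 ≤ n ∧ δ < 1 / (n : ℝ)} := by
  refine ⟨?_, fun α _ _ _ γ hγ => isDP_histogramLearner hd hε hδ hγ⟩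
  rintro α hα β hβ γ hγ n ⟨hn, hδn⟩ hm
  refine ⟨fun D => ?_, ?_⟩
  · filter_upwards [ae_card_histogramLearner_le hd hε hδ hα hγ hn D] with l hl
    have hγ1 : 0 < 1 - γ := sub_pos.2 hγ.2
    have hα0 := hα.1
    refine hl.trans (pow_le_pow_left₀ (by positivity) ?_ d)
    rw [show 80 / (1 - γ) * (3 * d / α) = 240 * (d / ((1 - γ) * α)) by field_simp; norm_num]
    exact mul_le_mul_of_nonneg_right (by norm_num) (by positivity)
  · rintro f ⟨μ, hf⟩ g hg
    obtain rfl : f = gaussianPM μ := Subtype.ext hf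
    exact histogramLearner_accurate hd hε hδ hα hβ hγ hn hδn hm μ hg

end Accuracy

end PrivateListDecoding

theorem mainTheorem5 :
    ∃ C : ℝ, 0 < C ∧
      ∀ d : ℕ, 1 ≤ d → ∀ ε ∈ Set.Ioo (0 : ℝ) 1, ∀ δ ∈ Set.Ioo (0 : ℝ) 1,
        ∃ A : ℝ → ℝ → ℝ → PrivateListDecoding.RandomizedAlgorithm (EuclideanSpace ℝ (Fin d))
            (PrivateListDecoding.DistList (EuclideanSpace ℝ (Fin d))),
          PrivateListDecoding.IsDPListDecodableLearner ε δ A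
            (PrivateListDecoding.identityGaussians d)
            (fun α _ γ => (C * (d / ((1 - γ) * α))) ^ d)
            (fun _ β γ => C * (d * Real.log (d / (β * δ)) / ((1 - γ) * ε)))
            {n : ℕ | 1 ≤ n ∧ δ < 1 / (n : ℝ)} := by
  exact ⟨1000, by norm_num, fun d hd ε hε δ hδ =>
    ⟨_, PrivateListDecoding.isDPListDecodableLearner_histogramLearner hd hε hδ⟩⟩
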